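/- Let $\mathbb H_{\mathbb R}$ be the real quaternions with units $e_1,e_2,e_3$, and $\mathbb H_{\mathbb C}$ the complex quaternions $p=p_0+\sum_{i=1}^3 p_ie_i$, $p_i\in\mathbb C$, with $|p|^2=\sum_{i=0}^3|p_i|^2$. On $L^2(\mathbb R,\mathbb H_{\mathbb C})$ let $T_k$ ($k\in\mathbb Z$) be the translation $(T_kf)(x)=f(x-k)$, let $D$ be the unitary dilation operator $(Df)(x)=\sqrt2\,f(2x)$, and let $\mathbb H_{\mathbb C}$ act by pointwise multiplication from the left. For $q=a+v\in\mathbb H_{\mathbb R}$ with scalar part $a=\operatorname{Sc}q$ and vector part $v$, and for $z\in\mathbb C$, put $z^q=z^a\bigl[\cos(|v|\log z)+\tfrac{v}{|v|}\sin(|v|\log z)\bigr]$ (principal branch; the second term is absent if $v=0$). For $\operatorname{Sc}q>1$ let $B_q\in L^2(\mathbb R,\mathbb H_{\mathbb C})$ be the function whose Fourier--Plancherel transform, normalised by $\widehat f(\xi)=\int_{\mathbb R}f(x)e^{-i\xi x}\,dx$, is $$\widehat{B_q}(\xi)=\Xi(\xi)^q,\qquad \Xi(\xi)=\frac{1-e^{-i\xi}}{i\xi}\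 (\xi\ne0),\quad \Xi(0)=1.$$ Theorem. Let $q\in\mathbb H_{\mathbb R}$ with $\operatorname{Sc}q>1$. For $n\in\mathbb Z$ let $V_n^q$ be the closure in $L^2(\mathbb R,\mathbb H_{\mathbb C})$ of the set of finite sums $\sum_k c_k\,D^nT_kB_q$ with coefficients $c_k\in\mathbb H_{\mathbb C}$. Then $\{V_n^q\}_{n\in\mathbb Z}$ is a dyadic multiresolution analysis of $L^2(\mathbb R,\mathbb H_{\mathbb C})$ with scaling function $B_q$, that is: 1. each $V_n^q$ is a closed linear subspace, stable under left multiplication by $\mathbb H_{\mathbb C}$, and $V_n^q\subseteq V_{n+1}^q$; 2. $\bigcup_{n}V_n^q$ is dense in $L^2(\mathbb R,\mathbb H_{\mathbb C})$ and $\bigcap_nV_n^q=\{0\}$; 3. for all $n\in\mathbb Z$ and all $f\in L^2(\mathbb R,\mathbb H_{\mathbb C})$, $f\in V_n^q$ if and only if $Df\in V_{n+1}^q$; 4. for all $k\in\mathbb Z$ and all $f\in L^2(\mathbb R,\mathbb H_{\mathbb C})$, $f\in V_0^q$ if and only if $T_kf\in V_0^q$; 5. $\{T_kB_q\}_{k\in\mathbb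 Z}$ is a Riesz basis of $V_0^q$ over $\mathbb H_{\mathbb C}$: its closed left $\mathbb H_{\mathbb C}$-span is $V_0^q$, and there are constants $A,B>0$ with $A\sum_k|c_k|^2\le\bigl\|\sum_kc_kT_kB_q\bigr\|_2^2\le B\sum_k|c_k|^2$ for all finitely supported $(c_k)_{k\in\mathbb Z}$ in $\mathbb H_{\mathbb C}$. -/

import Mathlib

open MeasureTheory Quaternion
open scoped ENNReal FourierTransform ComplexConjugate

noncomputable section

namespace QuaternionicSpline

/-! ### The complexified quaternions and the space of square-integrable functions -/

/-- The algebra of complex quaternions `a + v₁ e₁ + v₂ e₂ + v₃ e₃`, with complex `a, v₁, v₂, v₃`. -/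
def HC : Type := Quaternion ℂ

instance instRingHC : Ring HC := inferInstanceAs (Ring (Quaternion ℂ))

instance instAlgebraHC : Algebra ℂ HC := inferInstanceAs (Algebra ℂ (Quaternion ℂ))

instance instFiniteHC : Module.Finite ℂ HC := inferInstanceAs (Module.Finite ℂ (Quaternion ℂ))

/-- The inner product of complex quaternions is the sum of the products of the components, one of
them conjugated (in Mathlib's convention, the first one). -/
instance instInnerHC : Inner ℂ HC :=
  ⟨fun p q => conj p.re * q.re + conj p.imI * q.imI + conj p.imJ * q.imJ + conj p.imK * q.imK⟩

theorem inner_HC_def (p q : HC) : inner ℂ p q =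
    conj p.re * q.re + conj p.imI * q.imI + conj p.imJ * q.imJ + conj p.imK * q.imK := rfl

theorem inner_HC_self (p : HC) : inner ℂ p p =
    ((Complex.normSq p.re + Complex.normSq p.imI + Complex.normSq p.imJ
      + Complex.normSq p.imK : ℝ) : ℂ) := by
  simp only [inner_HC_def, ← Complex.normSq_eq_conj_mul_self]
  push_cast
  rfl

/-- The axioms of an inner product for the componentwise inner product. -/
@[reducible]
def innerCoreHC : InnerProductSpace.Core ℂ HC where
  toInner := instInnerHC
  conj_inner_symm p q := by
    simp only [inner_HC_def, map_add, map_mul, Complex.conj_conj]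
    ring
  re_inner_nonneg p := by
    rw [inner_HC_self]
    simp only [RCLike.re_to_complex, Complex.ofReal_re]
    have h1 := Complex.normSq_nonneg p.re
    have h2 := Complex.normSq_nonneg p.imI
    have h3 := Complex.normSq_nonneg p.imJ
    have h4 := Complex.normSq_nonneg p.imK
    linarith
  add_left p q r := by
    change conj (p.re + q.re) * r.re + conj (p.imI + q.imI) * r.imI
      + conj (p.imJ + q.imJ) * r.imJ + conj (p.imK + q.imK) * r.imK = _
    simp only [inner_HC_def, map_add]
    ring
  smul_left p q c := by
    change conj (c * p.re) * q.re + conj (c * p.imI) * q.imI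
      + conj (c * p.imJ) * q.imJ + conj (c * p.imK) * q.imK = _
    simp only [inner_HC_def, map_mul]
    ring
  definite p hp := by
    rw [inner_HC_self] at hp
    have h := Complex.ofReal_eq_zero.1 hp
    have h1 := Complex.normSq_nonneg p.re
    have h2 := Complex.normSq_nonneg p.imI
    have h3 := Complex.normSq_nonneg p.imJ
    have h4 := Complex.normSq_nonneg p.imK
    apply Quaternion.ext
    · exact Complex.normSq_eq_zero.1 (by linarith)
    · exact Complex.normSq_eq_zero.1 (by linarith)
    · exact Complex.normSq_eq_zero.1 (by linarith)
    · exact Complex.normSq_eq_zero.1 (by linarith)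

instance instNormedAddCommGroupHC : NormedAddCommGroup HC :=
  @InnerProductSpace.Core.toNormedAddCommGroup ℂ HC _ _ _ innerCoreHC

instance instInnerProductSpaceHC : InnerProductSpace ℂ HC :=
  InnerProductSpace.ofCore innerCoreHC.toCore

instance instCompleteSpaceHC : CompleteSpace HC := FiniteDimensional.complete ℂ HC

/-- The Hilbert space of (classes of) square-integrable functions on the line with values in the
complex quaternions. -/
abbrev L2HC : Type := Lp HC 2 (volume : Measure ℝ)

/-- Left multiplication by a complex quaternion, as an operator on complex quaternions. -/
def mulLeftHC (c : HC) : HC →L[ℂ] HC := LinearMap.toContinuousLinearMap (LinearMap.mulLeft ℂ c)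

/-- Pointwise left multiplication of functions by a complex quaternion: `(c f)(x) = c f(x)`. -/
def leftMul (c : HC) : L2HC →L[ℂ] L2HC := (mulLeftHC c).compLpL 2 volume

/-! ### Translations and the unitary dilation -/

/-- The translation `(T_t f)(x) = f(x - t)`. -/
def translation (t : ℝ) : L2HC →ₗᵢ[ℂ] L2HC :=
  Lp.compMeasurePreservingₗᵢ ℂ (fun x => x - t) (measurePreserving_sub_right volume t)

/-- Change of variables in the `L²` norm. -/
theorem eLpNorm_scale {c : ℝ} (hc : 0 < c) (f : L2HC) :
    eLpNorm (fun x => ((√c : ℝ) : ℂ) • f (c * x)) 2 volume = eLpNorm f 2 volume ∧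
      AEStronglyMeasurable (fun x => ((√c : ℝ) : ℂ) • f (c * x)) volume := by
  have hmap := Real.map_volume_mul_left hc.ne'
  have hf : AEStronglyMeasurable f (volume : Measure ℝ) := Lp.aestronglyMeasurable f
  have hf' : AEStronglyMeasurable f (Measure.map (c * ·) (volume : Measure ℝ)) := by
    rw [hmap]
    exact hf.smul_measure _
  have hm : AEMeasurable (c * ·) (volume : Measure ℝ) := (measurable_const_mul c).aemeasurable
  have hcomp : AEStronglyMeasurable (fun x => f (c * x)) volume := hf'.comp_aemeasurable hm
  have hsmul : AEStronglyMeasurable (((√c : ℝ) : ℂ) • fun x => f (c * x)) volume :=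
    hcomp.const_smul ((√c : ℝ) : ℂ)
  refine ⟨?_, hsmul⟩
  have h1 : eLpNorm (fun x => f (c * x)) 2 volume
      = eLpNorm f 2 (Measure.map (c * ·) (volume : Measure ℝ)) :=
    (eLpNorm_map_measure hf' hm).symm
  have h2 : eLpNorm (fun x => ((√c : ℝ) : ℂ) • f (c * x)) 2 volume
      = ‖((√c : ℝ) : ℂ)‖ₑ * eLpNorm (fun x => f (c * x)) 2 volume :=
    eLpNorm_const_smul ((√c : ℝ) : ℂ) (fun x => f (c * x)) 2 volume
  rw [h2, h1, hmap, eLpNorm_smul_measure_of_ne_top (by norm_num), smul_eq_mul, ← mul_assoc]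
  have h3 : ‖((√c : ℝ) : ℂ)‖ₑ * ENNReal.ofReal |c⁻¹| ^ (1 / (2 : ℝ≥0∞)).toReal = 1 := by
    rw [← ofReal_norm, ENNReal.ofReal_rpow_of_nonneg (abs_nonneg _) (by positivity),
      ← ENNReal.ofReal_mul (norm_nonneg _), Complex.norm_real, Real.norm_of_nonneg (by positivity),
      abs_of_pos (by positivity)]
    have : (1 / (2 : ℝ≥0∞)).toReal = 1 / 2 := by simp
    rw [this, ← Real.sqrt_eq_rpow, ← Real.sqrt_mul hc.le, mul_inv_cancel₀ hc.ne']
    simp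
  rw [h3, one_mul]

theorem memLp_scale {c : ℝ} (hc : 0 < c) (f : L2HC) :
    MemLp (fun x => ((√c : ℝ) : ℂ) • f (c * x)) 2 volume := by
  obtain ⟨h1, h2⟩ := eLpNorm_scale hc f
  refine ⟨h2, ?_⟩
  rw [h1]
  exact Lp.eLpNorm_lt_top f

theorem ae_scale {c : ℝ} (hc : 0 < c) {p : ℝ → Prop} (h : ∀ᵐ x ∂(volume : Measure ℝ), p x) :
    ∀ᵐ x ∂(volume : Measure ℝ), p (c * x) := by
  have hq : Measure.QuasiMeasurePreserving (c * ·) (volume : Measure ℝ) volume := by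
    refine ⟨measurable_const_mul c, ?_⟩
    rw [Real.map_volume_mul_left hc.ne']
    exact Measure.smul_absolutelyContinuous
  exact hq.ae h

/-- The normalised rescaling `f ↦ √c f(c ·)`, for `c > 0`, as a linear isometry of `L²`. -/
def scale {c : ℝ} (hc : 0 < c) : L2HC →ₗᵢ[ℂ] L2HC where
  toFun f := (memLp_scale hc f).toLp
  map_add' f g := by
    apply Lp.ext
    filter_upwards [(memLp_scale hc (f + g)).coeFn_toLp, (memLp_scale hc f).coeFn_toLp,
      (memLp_scale hc g).coeFn_toLp,
      Lp.coeFn_add (memLp_scale hc f).toLp (memLp_scale hc g).toLp,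
      ae_scale hc (Lp.coeFn_add f g)] with x h1 h2 h3 h4 h5
    rw [h1, h4, Pi.add_apply, h2, h3, h5, Pi.add_apply, smul_add]
  map_smul' a f := by
    apply Lp.ext
    filter_upwards [(memLp_scale hc (a • f)).coeFn_toLp, (memLp_scale hc f).coeFn_toLp,
      Lp.coeFn_smul a (memLp_scale hc f).toLp,
      ae_scale hc (Lp.coeFn_smul a f)] with x h1 h2 h3 h4
    rw [h1, RingHom.id_apply, h3, Pi.smul_apply, h2, h4, Pi.smul_apply, smul_comm]
  norm_map' f := by
    change ‖(memLp_scale hc f).toLp‖ = ‖f‖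
    rw [Lp.norm_toLp, (eLpNorm_scale hc f).1, Lp.norm_def]

theorem scale_coeFn {c : ℝ} (hc : 0 < c) (f : L2HC) :
    scale hc f =ᵐ[volume] fun x => ((√c : ℝ) : ℂ) • f (c * x) :=
  (memLp_scale hc f).coeFn_toLp

theorem scale_scale {c d : ℝ} (hc : 0 < c) (hd : 0 < d) (hcd : c * d = 1) (f : L2HC) :
    scale hc (scale hd f) = f := by
  apply Lp.ext
  filter_upwards [scale_coeFn hc (scale hd f), ae_scale hc (scale_coeFn hd f)] with x h1 h2
  rw [h1, h2, smul_smul, ← mul_assoc, mul_comm d c, hcd, one_mul, ← Complex.ofReal_mul,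
    ← Real.sqrt_mul hc.le, hcd]
  simp

/-- The unitary dilation operator `(D f)(x) = √2 f(2x)`. Its integer powers `D ^ n` are taken in
the group of unitary operators, so that `(D ^ n f)(x) = 2^(n/2) f(2^n x)` for every integer `n`. -/
def dilation : L2HC ≃ₗᵢ[ℂ] L2HC where
  toLinearEquiv := LinearEquiv.ofLinearMap
    (scale (two_pos : (0 : ℝ) < 2)).toLinearMap
    (scale (inv_pos.2 two_pos : (0 : ℝ) < 2⁻¹)).toLinearMap
    (LinearMap.ext fun f => scale_scale two_pos (inv_pos.2 two_pos) (by norm_num) f)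
    (LinearMap.ext fun f => scale_scale (inv_pos.2 two_pos) two_pos (by norm_num) f)
  norm_map' f := (scale (two_pos : (0 : ℝ) < 2)).norm_map f

/-! ### Quaternionic powers and B-splines -/

/-- The inclusion of the real quaternions into the complex quaternions. -/
def complexify (q : ℍ[ℝ]) : HC := ⟨q.re, q.imI, q.imJ, q.imK⟩

/-- The quaternionic power `z^q = z^a [cos(|v| log z) + (v/|v|) sin(|v| log z)]` for `q = a + v`,
with the principal branch of the logarithm; the second term is absent if `v = 0`. -/
def qpow (z : ℂ) (q : ℍ[ℝ]) : HC :=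
  (z ^ (q.re : ℂ)) •
    (Complex.cos (‖q.im‖ * Complex.log z) • (1 : HC) +
      (Complex.sin (‖q.im‖ * Complex.log z) / ‖q.im‖) • complexify q.im)

/-- The function `(1 - e^{-iξ}) / (iξ)`, with its removable singularity at `0` removed. -/
def Xi (ξ : ℝ) : ℂ :=
  if ξ = 0 then 1 else (1 - Complex.exp (-Complex.I * ξ)) / (Complex.I * ξ)

/-- The Fourier transform of the B-spline of order `q`, with the normalisation
`f̂(ξ) = ∫ f(x) e^{-iξx} dx`. -/
def bsplineHat (q : ℍ[ℝ]) (ξ : ℝ) : HC := qpow (Xi ξ) q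

theorem norm_Xi_le_one (ξ : ℝ) : ‖Xi ξ‖ ≤ 1 := by
  unfold Xi
  split_ifs with h
  · simp
  · rw [norm_div, norm_mul, Complex.norm_I, one_mul, Complex.norm_real]
    refine div_le_one_of_le₀ ?_ (norm_nonneg _)
    have := Real.norm_exp_I_mul_ofReal_sub_one_le (x := -ξ)
    rw [norm_sub_rev, norm_neg] at this
    have h' : -Complex.I * (ξ : ℂ) = Complex.I * ((-ξ : ℝ) : ℂ) := by push_cast; ring
    rw [h']
    exact this

theorem norm_Xi_sq_le (ξ : ℝ) : ‖Xi ξ‖ ^ 2 ≤ 5 * (1 + ξ ^ 2)⁻¹ := by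
  have h1 : ‖Xi ξ‖ ≤ 1 := norm_Xi_le_one ξ
  have h2 : ‖Xi ξ‖ * |ξ| ≤ 2 := by
    unfold Xi
    split_ifs with h
    · simp [h]
    · rw [norm_div, norm_mul, Complex.norm_I, one_mul, Complex.norm_real, Real.norm_eq_abs,
        div_mul_cancel₀ _ (abs_ne_zero.2 h)]
      refine (norm_sub_le _ _).trans ?_
      have : -Complex.I * (ξ : ℂ) = ((-ξ : ℝ) : ℂ) * Complex.I := by push_cast; ring
      rw [this, Complex.norm_exp_ofReal_mul_I, norm_one]
      norm_num
  rw [← div_eq_mul_inv, le_div_iff₀ (by positivity)]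
  have h3 : ‖Xi ξ‖ ^ 2 ≤ 1 := pow_le_one₀ (norm_nonneg _) h1
  have h4 : (‖Xi ξ‖ * |ξ|) ^ 2 ≤ 2 ^ 2 := pow_le_pow_left₀ (by positivity) h2 2
  rw [mul_pow, sq_abs] at h4
  linarith

theorem measurable_Xi : Measurable Xi := by
  unfold Xi
  refine Measurable.ite (measurableSet_eq) measurable_const ?_
  fun_prop

theorem norm_sin_cos_le (w : ℂ) :
    ‖Complex.sin w‖ ≤ Real.exp |w.im| ∧ ‖Complex.cos w‖ ≤ Real.exp |w.im| := by
  have ha : ‖Complex.exp (w * Complex.I)‖ ≤ Real.exp |w.im| := by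
    rw [Complex.norm_exp]
    apply Real.exp_le_exp.2
    simpa using neg_le_abs w.im
  have hb : ‖Complex.exp (-w * Complex.I)‖ ≤ Real.exp |w.im| := by
    rw [Complex.norm_exp]
    apply Real.exp_le_exp.2
    simpa using le_abs_self w.im
  constructor
  · rw [Complex.sin, norm_div, norm_mul, Complex.norm_I, mul_one]
    have := norm_sub_le (Complex.exp (-w * Complex.I)) (Complex.exp (w * Complex.I))
    have h2 : ‖(2 : ℂ)‖ = 2 := by simp
    rw [h2, div_le_iff₀ two_pos]
    linarith
  · rw [Complex.cos, norm_div]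
    have := norm_add_le (Complex.exp (w * Complex.I)) (Complex.exp (-w * Complex.I))
    have h2 : ‖(2 : ℂ)‖ = 2 := by simp
    rw [h2, div_le_iff₀ two_pos]
    linarith

theorem memLp_of_bound {a : ℝ} (ha : 1 < a) (C : ℝ) {g : ℝ → ℂ} (hg : Measurable g)
    (hgC : ∀ ξ, ‖g ξ‖ ≤ C) :
    MemLp (fun ξ : ℝ => Xi (2 * Real.pi * ξ) ^ (a : ℂ) * g ξ) 2 volume := by
  have hXi : MemLp (fun ξ : ℝ => Xi (2 * Real.pi * ξ)) 2 volume := by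
    have hm : Measurable (fun ξ : ℝ => Xi (2 * Real.pi * ξ)) :=
      measurable_Xi.comp (measurable_const_mul _)
    rw [memLp_two_iff_integrable_sq_norm hm.aestronglyMeasurable]
    refine (integrable_inv_one_add_sq.const_mul 5).mono' (hm.norm.pow_const 2).aestronglyMeasurable
      (Filter.Eventually.of_forall fun ξ => ?_)
    rw [Real.norm_of_nonneg (by positivity)]
    refine (norm_Xi_sq_le _).trans ?_
    have hpi : 1 ≤ 2 * Real.pi := by linarith [Real.pi_gt_three]
    have : ξ ^ 2 ≤ (2 * Real.pi * ξ) ^ 2 := by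
      rw [mul_pow]
      exact le_mul_of_one_le_left (sq_nonneg _) (one_le_pow₀ hpi)
    gcongr
  have hm : Measurable (fun ξ : ℝ => Xi (2 * Real.pi * ξ) ^ (a : ℂ) * g ξ) :=
    ((measurable_Xi.comp (measurable_const_mul _)).pow_const _).mul hg
  refine hXi.of_le_mul (c := C) hm.aestronglyMeasurable (Filter.Eventually.of_forall fun ξ => ?_)
  rw [norm_mul, Complex.norm_cpow_real, mul_comm]
  have h1 : ‖Xi (2 * Real.pi * ξ)‖ ^ a ≤ ‖Xi (2 * Real.pi * ξ)‖ :=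
    Real.rpow_le_self_of_le_one (norm_nonneg _) (norm_Xi_le_one _) ha.le
  have hC : 0 ≤ C := (norm_nonneg _).trans (hgC ξ)
  exact mul_le_mul (hgC ξ) h1 (by positivity) hC

theorem memLp_bsplineHat {q : ℍ[ℝ]} (hq : 1 < q.re) :
    MemLp (fun ξ : ℝ => bsplineHat q (2 * Real.pi * ξ)) 2 volume := by
  set r : ℝ := ‖q.im‖ with hr
  have hr0 : 0 ≤ r := norm_nonneg _
  have hmeas : Measurable fun ξ : ℝ => (r : ℂ) * Complex.log (Xi (2 * Real.pi * ξ)) :=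
    (Complex.measurable_log.comp (measurable_Xi.comp (measurable_const_mul _))).const_mul _
  have him : ∀ z : ℂ, |((r : ℂ) * Complex.log z).im| ≤ r * Real.pi := by
    intro z
    rw [Complex.im_ofReal_mul, Complex.log_im, abs_mul, abs_of_nonneg hr0]
    exact mul_le_mul_of_nonneg_left (Complex.abs_arg_le_pi z) hr0
  have h1 := memLp_of_bound hq (Real.exp (r * Real.pi))
    (Complex.measurable_cos.comp hmeas)
    (fun ξ => (norm_sin_cos_le _).2.trans (Real.exp_le_exp.2 (him _)))
  have h2 := memLp_of_bound hq (Real.exp (r * Real.pi) / ‖(r : ℂ)‖)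
    ((Complex.measurable_sin.comp hmeas).div_const (r : ℂ))
    (fun ξ => by
      rw [norm_div]
      exact div_le_div_of_nonneg_right
        ((norm_sin_cos_le _).1.trans (Real.exp_le_exp.2 (him _))) (norm_nonneg _))
  have h3 := (ContinuousLinearMap.toSpanSingleton ℂ (1 : HC)).comp_memLp' h1
  have h4 := (ContinuousLinearMap.toSpanSingleton ℂ (complexify q.im)).comp_memLp' h2
  refine (h3.add h4).ae_eq (Filter.Eventually.of_forall fun ξ => ?_)
  simp only [Pi.add_apply, Function.comp_apply, ContinuousLinearMap.toSpanSingleton_apply,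
    bsplineHat, qpow, smul_add, smul_smul, ← hr]

/-- The B-spline of quaternionic order `q`, `Sc q > 1`: the square-integrable function whose
Fourier-Plancherel transform (with the normalisation `f̂(ξ) = ∫ f(x) e^{-iξx} dx`) is
`bsplineHat q`. In Mathlib's normalisation `∫ f(x) e^{-2πiξx} dx` its transform is therefore the
function `ξ ↦ bsplineHat q (2πξ)`, and `𝓕⁻` is the inverse of that unitary transform. -/
def bspline (q : ℍ[ℝ]) (hq : 1 < q.re) : L2HC :=
  𝓕⁻ ((memLp_bsplineHat hq).toLp : L2HC)

/-! ### Multiresolution analyses -/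

/-- The closed span of a set of functions, with coefficients in the complex quaternions acting by
left multiplication: the closure of the set of finite sums `∑ c_j f_j`. -/
def closedLeftSpan (S : Set L2HC) : Submodule ℂ L2HC :=
  (Submodule.span ℂ {g : L2HC | ∃ c : HC, ∃ f ∈ S, g = leftMul c f}).topologicalClosure

/-- The integer translates of `φ` form a Riesz basis of `W`, with coefficients in the complex
quaternions acting from the left. -/
def IsRieszBasisOfShifts (φ : L2HC) (W : Submodule ℂ L2HC) : Prop :=
  closedLeftSpan (Set.range fun k : ℤ => translation k φ) = W ∧
    ∃ A B : ℝ, 0 < A ∧ 0 < B ∧ ∀ c : ℤ →₀ HC,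
      A * (∑ k ∈ c.support, ‖c k‖ ^ 2) ≤
          ‖∑ k ∈ c.support, leftMul (c k) (translation k φ)‖ ^ 2 ∧
        ‖∑ k ∈ c.support, leftMul (c k) (translation k φ)‖ ^ 2 ≤
          B * (∑ k ∈ c.support, ‖c k‖ ^ 2)

/-- `V` is a dyadic multiresolution analysis of the space of square-integrable functions with
values in the complex quaternions, with scaling function `φ`. -/
structure IsDyadicMRA (V : ℤ → Submodule ℂ L2HC) (φ : L2HC) : Prop where
  isClosed : ∀ n, IsClosed (V n : Set L2HC)
  leftMul_mem : ∀ n (c : HC), ∀ f ∈ V n, leftMul c f ∈ V n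
  nested : ∀ n, V n ≤ V (n + 1)
  dense_iUnion : Dense (⋃ n, (V n : Set L2HC))
  iInter_eq : ⋂ n, (V n : Set L2HC) = {0}
  dilation_mem_iff : ∀ n f, dilation f ∈ V (n + 1) ↔ f ∈ V n
  translation_mem_iff : ∀ (k : ℤ) f, translation k f ∈ V 0 ↔ f ∈ V 0
  rieszBasis : IsRieszBasisOfShifts φ (V 0)

/-- The shift-invariant spaces `V_n^q`, the closed spans of `{D^n T_k B_q : k ∈ ℤ}`. -/
def splineSpace (q : ℍ[ℝ]) (hq : 1 < q.re) (n : ℤ) : Submodule ℂ L2HC :=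
  closedLeftSpan (Set.range fun k : ℤ => (dilation ^ n) (translation k (bspline q hq)))

end QuaternionicSpline

end

noncomputable section

open scoped SchwartzMap BoundedContinuousFunction

namespace QuaternionicSpline

/-! Write `a = Sc q`, `v` for the vector part. By Plancherel everything is read off on the Fourier
side, where a finite sum `∑ c_k T_k B_q` becomes a trigonometric polynomial with coefficients `c_k`,
times `Ξ^q` on the right (`fourier_comb`). Now `Ξ^q = Ξ^a • exp(v log Ξ)`, and since `|Im log| ≤ π`
both `exp(v log Ξ)` and its inverse are bounded. So `‖c Ξ^q‖` is comparable to `‖c‖ |Ξ|^a`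
(`exists_norm_qpow_le`, `exists_le_norm_qpow`), and the size estimates are those of a scalar spline
of order `a`.

Riesz bounds: `|Ξ|` is bounded below on one period, and `|Ξ|^{2a}` is dominated by a multiple of
`1/(1 + ξ²)`. Since `a > 1`, a power of this weight is left over, which gives a uniform tail
estimate on `V_0`.

Nesting: `Ξ(2ξ) = Ξ(ξ)(1 + e^{-iξ})/2`, and the principal logarithm is additive on this product
(`qpow_Xi_two_mul`). The symbol `((1 + e^{-iξ})/2)^q` has continuous periodic coefficients, and
multiplication by these preserves `V_0` on the Fourier side (`fourierInv_periodicMul_mem`).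

Intersection: if `f` lies in every `V_n`, all `D^n f` with `n ≥ 0` lie in `V_0`, but dilation pushes
the frequencies of `f` to infinity. The tail estimate leaves no mass of `f̂` away from `0`.

Density: the spaces contain all dyadic translates of `B_q`. If `f` is orthogonal to them all, the
Fourier transform of the integrable function `⟨f̂, c Ξ^q⟩` vanishes at the dyadic points, hence
everywhere. As `Ξ^q` is invertible almost everywhere, `f = 0`. -/

/-! ### Operators on the Fourier side -/

/-- Two continuous maps on `L²` which agree on Schwartz functions are equal. -/
theorem eq_of_eq_on_schwartz {X : Type*} [TopologicalSpace X] [T2Space X] {A B : L2HC → X}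
    (hA : Continuous A) (hB : Continuous B)
    (h : ∀ f : 𝓢(ℝ, HC), A (f.toLp 2) = B (f.toLp 2)) (f : L2HC) : A f = B f :=
  DenseRange.induction_on (p := fun f => A f = B f)
    (SchwartzMap.denseRange_toLpCLM (F := HC) (p := 2) (μ := (volume : Measure ℝ))
      ENNReal.ofNat_ne_top) f
    (isClosed_eq hA hB) h

theorem coeFn_leftMul (c : HC) (f : L2HC) : leftMul c f =ᵐ[volume] fun x => c * f x :=
  (mulLeftHC c).coeFn_compLpL f

theorem coeFn_translation (t : ℝ) (f : L2HC) :
    translation t f =ᵐ[volume] fun x => f (x - t) :=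
  Lp.coeFn_compMeasurePreserving f (measurePreserving_sub_right volume t)

theorem coeFn_dilation (f : L2HC) :
    dilation f =ᵐ[volume] fun x => ((√2 : ℝ) : ℂ) • f (2 * x) :=
  scale_coeFn two_pos f

theorem coeFn_dilation_symm (f : L2HC) :
    dilation.symm f =ᵐ[volume] fun x => ((√(2⁻¹) : ℝ) : ℂ) • f (2⁻¹ * x) :=
  scale_coeFn (inv_pos.2 two_pos) f

theorem continuous_fourier_L2HC : Continuous (𝓕 : L2HC → L2HC) :=
  (Lp.fourierTransformₗᵢ ℝ HC).continuous

theorem fourier_leftMul (c : HC) (f : L2HC) : 𝓕 (leftMul c f) = leftMul c (𝓕 f) := by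
  refine eq_of_eq_on_schwartz (A := fun f => 𝓕 (leftMul c f)) (B := fun f => leftMul c (𝓕 f))
    (continuous_fourier_L2HC.comp (leftMul c).continuous)
    ((leftMul c).continuous.comp continuous_fourier_L2HC) (fun f => ?_) f
  have h : ∀ g : 𝓢(ℝ, HC), leftMul c (g.toLp 2) = (g.postcompCLM (mulLeftHC c)).toLp 2 := by
    intro g
    apply Lp.ext
    filter_upwards [coeFn_leftMul c (g.toLp 2), g.coeFn_toLp 2,
      (g.postcompCLM (mulLeftHC c)).coeFn_toLp 2] with x h1 h2 h3
    rw [h1, h2, h3]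
    rfl
  simp only [SchwartzMap.toLp_fourier_eq, h]
  congr 1
  ext ξ
  have := ContinuousLinearMap.integral_comp_comm (mulLeftHC c)
    ((Real.fourierIntegral_convergent_iff ξ).2 (f.integrable (μ := volume)))
  rw [SchwartzMap.postcompCLM_apply, SchwartzMap.fourier_coe, SchwartzMap.fourier_coe,
    Real.fourier_eq, Real.fourier_eq, ← this]
  congr 1
  ext v
  rw [SchwartzMap.postcompCLM_apply, Circle.smul_def, Circle.smul_def, map_smul]


/-- The product of a bounded continuous function and a square-integrable one. -/
theorem memLp_bcf_smul (h : ℝ →ᵇ ℂ) (f : L2HC) : MemLp (fun x => h x • f x) 2 volume := by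
  refine (Lp.memLp f).of_le_mul (c := ‖h‖)
    (h.continuous.aestronglyMeasurable.smul (Lp.aestronglyMeasurable f))
    (Filter.Eventually.of_forall fun x => ?_)
  rw [norm_smul]
  exact mul_le_mul_of_nonneg_right (h.norm_coe_le_norm x) (norm_nonneg _)

/-- Multiplication of square-integrable functions by bounded continuous functions. -/
def bcfMul : (ℝ →ᵇ ℂ) →L[ℂ] L2HC →L[ℂ] L2HC :=
  LinearMap.mkContinuous₂
    (LinearMap.mk₂ ℂ (fun h f => (memLp_bcf_smul h f).toLp)
      (fun h₁ h₂ f => by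
        apply Lp.ext
        filter_upwards [(memLp_bcf_smul (h₁ + h₂) f).coeFn_toLp, (memLp_bcf_smul h₁ f).coeFn_toLp,
          (memLp_bcf_smul h₂ f).coeFn_toLp,
          Lp.coeFn_add (memLp_bcf_smul h₁ f).toLp (memLp_bcf_smul h₂ f).toLp] with x e1 e2 e3 e4
        rw [e1, e4, Pi.add_apply, e2, e3, BoundedContinuousFunction.add_apply, add_smul])
      (fun c h f => by
        apply Lp.ext
        filter_upwards [(memLp_bcf_smul (c • h) f).coeFn_toLp, (memLp_bcf_smul h f).coeFn_toLp,
          Lp.coeFn_smul c (memLp_bcf_smul h f).toLp] with x e1 e2 e3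
        rw [e1, e3, Pi.smul_apply, e2, BoundedContinuousFunction.smul_apply, smul_assoc])
      (fun h f₁ f₂ => by
        apply Lp.ext
        filter_upwards [(memLp_bcf_smul h (f₁ + f₂)).coeFn_toLp, (memLp_bcf_smul h f₁).coeFn_toLp,
          (memLp_bcf_smul h f₂).coeFn_toLp, Lp.coeFn_add f₁ f₂,
          Lp.coeFn_add (memLp_bcf_smul h f₁).toLp (memLp_bcf_smul h f₂).toLp] with x e1 e2 e3 e4 e5
        rw [e1, e5, Pi.add_apply, e2, e3, e4, Pi.add_apply, smul_add])
      (fun c h f => by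
        apply Lp.ext
        filter_upwards [(memLp_bcf_smul h (c • f)).coeFn_toLp, (memLp_bcf_smul h f).coeFn_toLp,
          Lp.coeFn_smul c (memLp_bcf_smul h f).toLp, Lp.coeFn_smul c f] with x e1 e2 e3 e4
        rw [e1, e3, Pi.smul_apply, e2, e4, Pi.smul_apply, smul_comm]))
    1 (fun h f => by
      rw [one_mul]
      refine Lp.norm_le_mul_norm_of_ae_le_mul ?_
      filter_upwards [(memLp_bcf_smul h f).coeFn_toLp] with x e1
      change ‖((memLp_bcf_smul h f).toLp : L2HC) x‖ ≤ _
      rw [e1, norm_smul]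
      exact mul_le_mul_of_nonneg_right (h.norm_coe_le_norm x) (norm_nonneg _))

theorem coeFn_bcfMul (h : ℝ →ᵇ ℂ) (f : L2HC) : bcfMul h f =ᵐ[volume] fun x => h x • f x :=
  (memLp_bcf_smul h f).coeFn_toLp

/-- The character `ξ ↦ e^{-2πitξ}`. -/
def character (t : ℝ) : ℝ →ᵇ ℂ :=
  BoundedContinuousFunction.ofNormedAddCommGroup (fun ξ : ℝ => (Real.fourierChar (-(ξ * t)) : ℂ))
    (by fun_prop) 1 (fun ξ => (Circle.norm_coe _).le)

theorem character_apply (t ξ : ℝ) : character t ξ = (Real.fourierChar (-(ξ * t)) : ℂ) := rfl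

theorem fourier_translation (t : ℝ) (f : L2HC) :
    𝓕 (translation t f) = bcfMul (character t) (𝓕 f) := by
  refine eq_of_eq_on_schwartz (A := fun f => 𝓕 (translation t f))
    (B := fun f => bcfMul (character t) (𝓕 f))
    (continuous_fourier_L2HC.comp (translation t).continuous)
    ((bcfMul (character t)).continuous.comp continuous_fourier_L2HC) (fun f => ?_) f
  have h : translation t (f.toLp 2) = (f.compSubConstCLM ℂ t).toLp 2 := by
    apply Lp.ext
    filter_upwards [coeFn_translation t (f.toLp 2),
      (measurePreserving_sub_right volume t).quasiMeasurePreserving.ae (f.coeFn_toLp 2 volume),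
      (f.compSubConstCLM ℂ t).coeFn_toLp 2] with x h1 h2 h3
    rw [h1, h2, h3]
    rfl
  simp only [SchwartzMap.toLp_fourier_eq, h]
  apply Lp.ext
  filter_upwards [(𝓕 (f.compSubConstCLM ℂ t)).coeFn_toLp 2,
    coeFn_bcfMul (character t) ((𝓕 f).toLp 2), (𝓕 f).coeFn_toLp 2] with ξ h1 h2 h3
  rw [h1, h2, h3, SchwartzMap.fourier_coe, SchwartzMap.fourier_coe, Real.fourier_real_eq,
    Real.fourier_real_eq, ← integral_smul,
    ← integral_sub_right_eq_self (fun x => character t ξ • Real.fourierChar (-(x * ξ)) • f x) t]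
  congr 1
  ext x
  simp only [SchwartzMap.compSubConstCLM_apply, Circle.smul_def, smul_smul, character_apply]
  rw [← Circle.coe_mul, ← AddChar.map_add_eq_mul]
  congr 3
  ring

/-- Substituting `x ↦ 2x` produces the Jacobian `1/2`, which turns the normalising factor `√2` into
`√(1/2)`, that of the inverse dilation. -/
theorem fourier_dilation (f : L2HC) : 𝓕 (dilation f) = dilation.symm (𝓕 f) := by
  refine eq_of_eq_on_schwartz (A := fun f => 𝓕 (dilation f)) (B := fun f => dilation.symm (𝓕 f))
    (continuous_fourier_L2HC.comp dilation.continuous)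
    (dilation.symm.continuous.comp continuous_fourier_L2HC) (fun f => ?_) f
  set g : 𝓢(ℝ, HC) := ((√2 : ℝ) : ℂ) • SchwartzMap.compCLMOfContinuousLinearEquiv ℂ
    (ContinuousLinearEquiv.unitsEquivAut ℝ (Units.mk0 (2 : ℝ) two_ne_zero)) f with hg
  have hgx : ∀ x, g x = ((√2 : ℝ) : ℂ) • f (2 * x) := fun x => by
    rw [hg, smul_apply, SchwartzMap.compCLMOfContinuousLinearEquiv_apply]
    simp [mul_comm]
  have h : dilation (f.toLp 2) = g.toLp 2 := by
    apply Lp.ext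
    filter_upwards [coeFn_dilation (f.toLp 2), ae_scale two_pos (f.coeFn_toLp 2 volume),
      g.coeFn_toLp 2] with x h1 h2 h3
    rw [h1, h2, h3, hgx]
  simp only [SchwartzMap.toLp_fourier_eq, h]
  apply Lp.ext
  filter_upwards [(𝓕 g).coeFn_toLp 2, coeFn_dilation_symm ((𝓕 f).toLp 2),
    ae_scale (inv_pos.2 two_pos) ((𝓕 f).coeFn_toLp 2 volume)] with ξ h1 h2 h3
  rw [h1, h2, h3, SchwartzMap.fourier_coe, SchwartzMap.fourier_coe, Real.fourier_real_eq,
    Real.fourier_real_eq]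
  have key := Measure.integral_comp_mul_left
    (fun x => Real.fourierChar (-(x * (2⁻¹ * ξ))) • f x) (2 : ℝ)
  have hs : ((√2 : ℝ) : ℂ) * (((|(2:ℝ)⁻¹| : ℝ)) : ℂ) = ((√(2⁻¹) : ℝ) : ℂ) := by
    rw [← Complex.ofReal_mul]
    congr 1
    rw [abs_of_pos (by norm_num), Real.sqrt_inv]
    field_simp
    norm_num
  rw [← hs, mul_smul, Complex.coe_smul |2⁻¹|, ← key, ← integral_smul]
  congr 1
  ext x
  rw [hgx, Circle.smul_def, Circle.smul_def, smul_comm]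
  congr 4
  ring

/-! ### The algebra of quaternionic powers -/

/-- The Euclidean norm of complex quaternions is not submultiplicative, as `p = 1 + i e₁` with `q =
p` shows. A constant exists because a bilinear map in finite dimension is bounded. -/
theorem exists_norm_mul_le : ∃ K : ℝ, 0 < K ∧ ∀ p q : HC, ‖p * q‖ ≤ K * ‖p‖ * ‖q‖ := by
  let T : HC →L[ℂ] HC →L[ℂ] HC := LinearMap.toContinuousLinearMap
    ((LinearMap.toContinuousLinearMap (𝕜 := ℂ) (E := HC) (F' := HC)).toLinearMap ∘ₗ
      LinearMap.mul ℂ HC)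
  refine ⟨‖T‖ + 1, by positivity, fun p q => ?_⟩
  have h : ‖p * q‖ ≤ ‖T‖ * ‖p‖ * ‖q‖ := T.le_opNorm₂ p q
  refine h.trans ?_
  gcongr
  linarith

theorem complexify_im_mul_self (q : ℍ[ℝ]) :
    complexify q.im * complexify q.im = (-((‖q.im‖ : ℂ) ^ 2)) • (1 : HC) := by
  have h : (‖q.im‖ : ℂ) ^ 2 = (q.imI : ℂ) ^ 2 + (q.imJ : ℂ) ^ 2 + (q.imK : ℂ) ^ 2 := by
    have h1 : ‖q.im‖ ^ 2 = q.imI ^ 2 + q.imJ ^ 2 + q.imK ^ 2 := by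
      rw [sq, ← Quaternion.normSq_eq_norm_mul_self, Quaternion.normSq_def']
      simp
    exact_mod_cast congrArg (fun x : ℝ => (x : ℂ)) h1
  rw [h]
  change (⟨_, _, _, _⟩ : Quaternion ℂ) * ⟨_, _, _, _⟩ = (_ : ℂ) • (1 : Quaternion ℂ)
  ext
  all_goals simp
  all_goals ring

/-- The one-parameter group `s ↦ exp(s v)`, `v` being the vector part of `q`. -/
def rotor (q : ℍ[ℝ]) (s : ℂ) : HC :=
  Complex.cos (‖q.im‖ * s) • (1 : HC) + (Complex.sin (‖q.im‖ * s) / ‖q.im‖) • complexify q.im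

theorem qpow_eq (z : ℂ) (q : ℍ[ℝ]) : qpow z q = z ^ (q.re : ℂ) • rotor q (Complex.log z) := rfl

theorem rotor_add (q : ℍ[ℝ]) (s t : ℂ) : rotor q (s + t) = rotor q s * rotor q t := by
  simp only [rotor, mul_add, add_mul, smul_mul_smul_comm, one_mul, mul_one,
    complexify_im_mul_self, smul_smul, Complex.cos_add, Complex.sin_add]
  -- For `v = 0`, division by zero gives `0` and the rotor is constantly `1`. Otherwise `v² = -|v|²`
  -- supplies the sign in the addition theorem of the cosine.
  by_cases hr : (‖q.im‖ : ℂ) = 0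
  · simp [hr]
  · have h : Complex.sin (‖q.im‖ * s) / ‖q.im‖ * (Complex.sin (‖q.im‖ * t) / ‖q.im‖) *
        -((‖q.im‖ : ℂ) ^ 2) = -(Complex.sin (‖q.im‖ * s) * Complex.sin (‖q.im‖ * t)) := by
      field_simp
    rw [h]
    module

theorem rotor_zero (q : ℍ[ℝ]) : rotor q 0 = 1 := by simp [rotor]

theorem norm_sin_cos_log_le (q : ℍ[ℝ]) {s : ℂ} (hs : |s.im| ≤ Real.pi) :
    ‖Complex.sin (‖q.im‖ * s)‖ ≤ Real.exp (‖q.im‖ * Real.pi) ∧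
      ‖Complex.cos (‖q.im‖ * s)‖ ≤ Real.exp (‖q.im‖ * Real.pi) := by
  have h : |((‖q.im‖ : ℂ) * s).im| ≤ ‖q.im‖ * Real.pi := by
    rw [Complex.im_ofReal_mul, abs_mul, abs_of_nonneg (norm_nonneg _)]
    exact mul_le_mul_of_nonneg_left hs (norm_nonneg _)
  exact ⟨(norm_sin_cos_le _).1.trans (Real.exp_le_exp.2 h),
    (norm_sin_cos_le _).2.trans (Real.exp_le_exp.2 h)⟩

/-- The strip contains both `log z` and `-log z` for the principal branch, so one bound serves for
the rotor factor of `z^q` and for its inverse. -/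
theorem exists_norm_rotor_le (q : ℍ[ℝ]) :
    ∃ K : ℝ, 0 < K ∧ ∀ s : ℂ, |s.im| ≤ Real.pi → ‖rotor q s‖ ≤ K := by
  set e := Real.exp (‖q.im‖ * Real.pi)
  refine ⟨e * ‖(1 : HC)‖ + e / ‖q.im‖ * ‖complexify q.im‖ + 1, by positivity, fun s hs => ?_⟩
  obtain ⟨h1, h2⟩ := norm_sin_cos_log_le q hs
  rw [rotor]
  refine (norm_add_le _ _).trans (le_trans ?_ (le_add_of_nonneg_right zero_le_one))
  rw [norm_smul, norm_smul, norm_div, Complex.norm_real, norm_norm]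
  gcongr

theorem exists_norm_qpow_le (q : ℍ[ℝ]) :
    ∃ K : ℝ, 0 < K ∧ ∀ (c : HC) (z : ℂ), ‖c * qpow z q‖ ≤ K * ‖c‖ * ‖z‖ ^ q.re := by
  obtain ⟨K₁, h₁, H₁⟩ := exists_norm_mul_le
  obtain ⟨K₂, h₂, H₂⟩ := exists_norm_rotor_le q
  refine ⟨K₁ * K₂, by positivity, fun c z => ?_⟩
  rw [qpow_eq, mul_smul_comm, norm_smul, Complex.norm_cpow_real]
  have h := H₂ (Complex.log z) (by rw [Complex.log_im]; exact Complex.abs_arg_le_pi z)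
  calc ‖z‖ ^ q.re * ‖c * rotor q (Complex.log z)‖
      ≤ ‖z‖ ^ q.re * (K₁ * ‖c‖ * K₂) := by
        gcongr
        exact (H₁ _ _).trans (by gcongr)
    _ = K₁ * K₂ * ‖c‖ * ‖z‖ ^ q.re := by ring

/-- Complex quaternions have zero divisors, so a lower bound is not automatic. Here the factor
`exp(v log z)` is undone by multiplying on the right by `exp(-v log z)`, which is bounded. -/
theorem exists_le_norm_qpow (q : ℍ[ℝ]) :
    ∃ K : ℝ, 0 < K ∧ ∀ (c : HC) (z : ℂ), ‖z‖ ^ q.re * ‖c‖ ≤ K * ‖c * qpow z q‖ := by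
  obtain ⟨K₁, h₁, H₁⟩ := exists_norm_mul_le
  obtain ⟨K₂, h₂, H₂⟩ := exists_norm_rotor_le q
  refine ⟨K₁ * K₂, by positivity, fun c z => ?_⟩
  have h := H₂ (-Complex.log z)
    (by rw [Complex.neg_im, abs_neg, Complex.log_im]; exact Complex.abs_arg_le_pi z)
  have hc : c * qpow z q * rotor q (-Complex.log z) = z ^ (q.re : ℂ) • c := by
    rw [qpow_eq, mul_smul_comm, smul_mul_assoc, mul_assoc, ← rotor_add, add_neg_cancel, rotor_zero,
      mul_one]
  calc ‖z‖ ^ q.re * ‖c‖ = ‖c * qpow z q * rotor q (-Complex.log z)‖ := by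
        rw [hc, norm_smul, Complex.norm_cpow_real]
    _ ≤ K₁ * ‖c * qpow z q‖ * K₂ := (H₁ _ _).trans (by gcongr)
    _ = K₁ * K₂ * ‖c * qpow z q‖ := by ring

theorem qpow_mul {z w : ℂ} (hz : z ≠ 0) (hw : w ≠ 0)
    (h : Complex.log (z * w) = Complex.log z + Complex.log w) (q : ℍ[ℝ]) :
    qpow (z * w) q = qpow z q * qpow w q := by
  rw [qpow_eq, qpow_eq, qpow_eq, smul_mul_smul_comm, h, rotor_add,
    Complex.cpow_def_of_ne_zero (mul_ne_zero hz hw), Complex.cpow_def_of_ne_zero hz,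
    Complex.cpow_def_of_ne_zero hw, h, add_mul, Complex.exp_add]

/-! ### The symbol `Ξ` -/

theorem im_mul_eq (z w : ℂ) : (z * w).im = ‖z‖ * ‖w‖ * Real.sin (z.arg + w.arg) := by
  rw [Complex.mul_im, Real.sin_add]
  nth_rewrite 1 [← Complex.norm_mul_cos_arg z]
  nth_rewrite 1 [← Complex.norm_mul_sin_arg z]
  nth_rewrite 1 [← Complex.norm_mul_cos_arg w]
  nth_rewrite 1 [← Complex.norm_mul_sin_arg w]
  ring

/-- The arguments lie in `(-π, 0)` and `(-π/2, π/2)`, so their sum could only overshoot below `-π`.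
It would then lie in `(-3π/2, -π]`, where the sine is nonnegative, against the sign of the product's
imaginary part. -/
theorem log_mul_of_im_neg {z w : ℂ} (hz : z.im < 0) (hw : 0 < w.re) (hzw : (z * w).im < 0) :
    Complex.log (z * w) = Complex.log z + Complex.log w := by
  have hz0 : z ≠ 0 := fun h => by simp [h] at hz
  have hw0 : w ≠ 0 := fun h => by simp [h] at hw
  have h1 := Complex.arg_neg_iff.2 hz
  have h2 := abs_lt.1 (Complex.abs_arg_lt_pi_div_two_iff.2 (Or.inl hw))
  have h3 := Complex.neg_pi_lt_arg z
  have hpi := Real.pi_pos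
  refine (Complex.log_mul_eq_add_log_iff hz0 hw0).2 ⟨?_, by linarith⟩
  by_contra! hcon
  rw [im_mul_eq] at hzw
  have h4 : 0 ≤ Real.sin (z.arg + w.arg) := by
    rw [← Real.sin_add_two_pi]
    exact Real.sin_nonneg_of_nonneg_of_le_pi (by linarith) (by linarith)
  exact absurd hzw (not_lt.2 (by positivity))

theorem log_mul_of_im_pos {z w : ℂ} (hz : 0 < z.im) (hw : 0 < w.re) (hzw : 0 < (z * w).im) :
    Complex.log (z * w) = Complex.log z + Complex.log w := by
  have hz0 : z ≠ 0 := fun h => by simp [h] at hz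
  have hw0 : w ≠ 0 := fun h => by simp [h] at hw
  have h1 := Complex.arg_nonneg_iff.2 hz.le
  have h2 := abs_lt.1 (Complex.abs_arg_lt_pi_div_two_iff.2 (Or.inl hw))
  have h3 := Complex.arg_le_pi z
  have hpi := Real.pi_pos
  refine (Complex.log_mul_eq_add_log_iff hz0 hw0).2 ⟨by linarith, ?_⟩
  by_contra! hcon
  rw [im_mul_eq] at hzw
  have h4 : Real.sin (z.arg + w.arg) ≤ 0 := by
    rw [← Real.sin_sub_two_pi]
    exact Real.sin_nonpos_of_nonpos_of_neg_pi_le (by linarith) (by linarith)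
  exact absurd hzw (not_lt.2 (mul_nonpos_of_nonneg_of_nonpos (by positivity) h4))

theorem im_Xi {ξ : ℝ} (hξ : ξ ≠ 0) : (Xi ξ).im = (Real.cos ξ - 1) / ξ := by
  have h : -Complex.I * (ξ : ℂ) = ((-ξ : ℝ) : ℂ) * Complex.I := by push_cast; ring
  have h' : (ξ : ℂ) ≠ 0 := Complex.ofReal_ne_zero.2 hξ
  rw [Xi, if_neg hξ, h, Complex.exp_mul_I, ← Complex.ofReal_cos, ← Complex.ofReal_sin,
    Real.cos_neg, Real.sin_neg]
  have : (1 - ((Real.cos ξ : ℂ) + ((-Real.sin ξ : ℝ) : ℂ) * Complex.I)) / (Complex.I * ξ)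
      = ((Real.sin ξ / ξ : ℝ) : ℂ) + (((Real.cos ξ - 1) / ξ : ℝ) : ℂ) * Complex.I := by
    push_cast
    field_simp
    ring_nf
    rw [Complex.I_sq]
    ring
  rw [this, Complex.add_im, Complex.ofReal_im, zero_add, Complex.im_ofReal_mul, Complex.I_im,
    mul_one]

theorem Xi_two_mul (ξ : ℝ) :
    Xi (2 * ξ) = Xi ξ * ((1 + Complex.exp (-Complex.I * ξ)) / 2) := by
  by_cases hξ : ξ = 0
  · simp [hξ, Xi]
  have h' : (ξ : ℂ) ≠ 0 := Complex.ofReal_ne_zero.2 hξ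
  have h2 : Complex.exp (-Complex.I * ((2 * ξ : ℝ) : ℂ)) = Complex.exp (-Complex.I * ξ) ^ 2 := by
    rw [← Complex.exp_nat_mul]
    congr 1
    push_cast
    ring
  rw [Xi, Xi, if_neg hξ, if_neg (mul_ne_zero two_ne_zero hξ), h2]
  push_cast
  field_simp
  ring

theorem norm_Xi {ξ : ℝ} (hξ : ξ ≠ 0) : ‖Xi ξ‖ = 2 * |Real.sin (ξ / 2)| / |ξ| := by
  have h : -Complex.I * (ξ : ℂ) = Complex.I * ((-ξ : ℝ) : ℂ) := by push_cast; ring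
  rw [Xi, if_neg hξ, norm_div, norm_mul, Complex.norm_I, one_mul, Complex.norm_real, norm_sub_rev, h,
    Complex.norm_exp_I_mul_ofReal_sub_one, neg_div, Real.sin_neg]
  simp

/-- Jordan's inequality `|sin x| ≥ 2|x|/π` at `x = ξ/2`. -/
theorem two_div_pi_le_norm_Xi {ξ : ℝ} (hξ : |ξ| ≤ Real.pi) : 2 / Real.pi ≤ ‖Xi ξ‖ := by
  have hpi := Real.pi_pos
  by_cases h0 : ξ = 0
  · simp only [h0, Xi, if_true, norm_one]
    rw [div_le_one hpi]
    exact Real.two_le_pi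
  · rw [norm_Xi h0, le_div_iff₀ (abs_pos.2 h0)]
    have := Real.mul_abs_le_abs_sin (x := ξ / 2) (by rw [abs_div, abs_two]; linarith)
    rw [abs_div, abs_two] at this
    linarith

/-- Off the multiples of `π`, the imaginary parts of `Ξ(ξ)` and `Ξ(2ξ)` both have the sign of `-ξ`,
and `(1 + e^{-iξ})/2` has positive real part. The product therefore does not cross the branch cut.
The symbol is put on the left, where it acts as coefficients do. -/
theorem qpow_Xi_two_mul {ξ : ℝ} (hξ : Real.sin ξ ≠ 0) (q : ℍ[ℝ]) :
    qpow (Xi (2 * ξ)) q =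
      qpow ((1 + Complex.exp (-Complex.I * ξ)) / 2) q * qpow (Xi ξ) q := by
  have h0 : ξ ≠ 0 := fun h => hξ (by simp [h])
  have hcos : Real.cos ξ < 1 ∧ -1 < Real.cos ξ := by
    have := Real.sin_sq_add_cos_sq ξ
    have h2 : 0 < Real.sin ξ ^ 2 := by positivity
    constructor <;> nlinarith
  have hcos2 : Real.cos (2 * ξ) < 1 := by
    rw [Real.cos_two_mul]
    nlinarith
  have hre : 0 < ((1 + Complex.exp (-Complex.I * ξ)) / 2).re := by
    have h : -Complex.I * (ξ : ℂ) = ((-ξ : ℝ) : ℂ) * Complex.I := by push_cast; ring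
    rw [h, Complex.exp_mul_I, ← Complex.ofReal_cos, ← Complex.ofReal_sin, Real.cos_neg,
      Real.sin_neg, Complex.div_ofNat_re, Complex.add_re, Complex.add_re, Complex.re_ofReal_mul,
      Complex.ofReal_re, Complex.I_re, Complex.one_re]
    linarith
  have hw0 : (1 + Complex.exp (-Complex.I * ξ)) / 2 ≠ 0 := by
    intro h
    rw [h] at hre
    exact lt_irrefl _ hre
  have him2 := im_Xi (mul_ne_zero two_ne_zero h0)
  rw [Xi_two_mul] at him2 ⊢
  have hz0 : Xi ξ ≠ 0 := by
    intro h
    have := im_Xi h0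
    rw [h, Complex.zero_im, eq_comm, div_eq_zero_iff] at this
    rcases this with h | h
    · linarith
    · exact h0 h
  have hlog : Complex.log (Xi ξ * ((1 + Complex.exp (-Complex.I * ξ)) / 2)) =
      Complex.log (Xi ξ) + Complex.log ((1 + Complex.exp (-Complex.I * ξ)) / 2) := by
    rcases lt_or_gt_of_ne h0 with h | h
    · refine log_mul_of_im_pos ?_ hre ?_
      · rw [im_Xi h0]
        exact div_pos_of_neg_of_neg (by linarith) h
      · rw [him2]
        exact div_pos_of_neg_of_neg (by linarith) (by linarith)
    · refine log_mul_of_im_neg ?_ hre ?_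
      · rw [im_Xi h0]
        exact div_neg_of_neg_of_pos (by linarith) h
      · rw [him2]
        exact div_neg_of_neg_of_pos (by linarith) (by linarith)
  rw [mul_comm (Xi ξ), add_comm (Complex.log _)] at hlog
  rw [mul_comm (Xi ξ)]
  exact qpow_mul hw0 hz0 hlog q

/-- The scalar coefficients of a quaternionic power of positive order are continuous on the slit
plane and at the origin. -/
theorem continuousAt_cpow_mul {a : ℝ} (ha : 0 < a) {F : ℂ → ℂ} {C : ℝ} (hC : ∀ z, ‖F z‖ ≤ C)
    (hF : ∀ z ∈ Complex.slitPlane, ContinuousAt F z) {z : ℂ} (hz : z ∈ Complex.slitPlane ∨ z = 0) :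
    ContinuousAt (fun z => z ^ (a : ℂ) * F z) z := by
  rcases hz with hz | rfl
  · exact (continuousAt_id.cpow continuousAt_const hz).mul (hF z hz)
  -- At the origin `F` need only be bounded: `|z|^a` tends to `0` because `a > 0`.
  · have h : Filter.Tendsto (fun z : ℂ => ‖z‖ ^ a * C) (nhds 0) (nhds 0) := by
      have : ContinuousAt (fun z : ℂ => ‖z‖ ^ a * C) 0 :=
        (continuous_norm.continuousAt.rpow_const (Or.inr ha.le)).mul continuousAt_const
      simpa [ContinuousAt, Real.zero_rpow ha.ne'] using this
    have h0 : (0 : ℂ) ^ (a : ℂ) * F 0 = 0 := by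
      rw [Complex.zero_cpow (Complex.ofReal_ne_zero.2 ha.ne'), zero_mul]
    rw [ContinuousAt, h0]
    refine squeeze_zero_norm (fun z => ?_) h
    rw [norm_mul, Complex.norm_cpow_real]
    exact mul_le_mul_of_nonneg_left (hC z) (by positivity)

/-- The point runs over the circle with centre and radius `1/2`, which lies in the right half-plane
except for its point of tangency `0`. -/
theorem half_one_add_mem_slitPlane {z : ℂ} (hz : ‖z‖ = 1) :
    (1 + z) / 2 ∈ Complex.slitPlane ∨ (1 + z) / 2 = 0 := by
  by_cases h : z = -1
  · right
    simp [h]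
  · left
    left
    have h1 : |z.re| ≤ 1 := hz ▸ Complex.abs_re_le_norm z
    have h2 : z.re ≠ -1 := by
      intro h2
      apply h
      have h3 : z.re * z.re + z.im * z.im = 1 := by
        rw [← Complex.normSq_apply, Complex.normSq_eq_norm_sq, hz, one_pow]
      apply Complex.ext
      · simpa using h2
      · rw [h2] at h3
        have : z.im = 0 := by nlinarith
        simpa using this
    have h4 : -1 < z.re := lt_of_le_of_ne (abs_le.1 h1).1 (Ne.symm h2)
    simp
    linarith

/-- The two-scale symbol `((1 + e^{-2πix}) / 2) ^ q` on the circle is `h₁ + h₂ v` with continuous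
scalar functions `h₁`, `h₂`. -/
theorem exists_symbol {q : ℍ[ℝ]} (hq : 0 < q.re) : ∃ h₁ h₂ : C(UnitAddCircle, ℂ),
    ∀ x, qpow ((1 + fourier (-1) x) / 2) q = h₁ x • (1 : HC) + h₂ x • complexify q.im := by
  have him : ∀ z : ℂ, |(Complex.log z).im| ≤ Real.pi := fun z => by
    rw [Complex.log_im]
    exact Complex.abs_arg_le_pi z
  have hcont : ∀ {F : ℂ → ℂ} {C : ℝ}, (∀ z, ‖F z‖ ≤ C) →
      (∀ z ∈ Complex.slitPlane, ContinuousAt F z) →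
      Continuous fun x : UnitAddCircle =>
        ((1 + fourier (-1) x) / 2) ^ (q.re : ℂ) * F ((1 + fourier (-1) x) / 2) := by
    intro F C hC hF
    rw [continuous_iff_continuousAt]
    intro x
    exact ContinuousAt.comp (f := fun x : UnitAddCircle => (1 + fourier (-1) x) / 2)
      (g := fun z : ℂ => z ^ (q.re : ℂ) * F z)
      (continuousAt_cpow_mul hq hC hF (half_one_add_mem_slitPlane (Circle.norm_coe _)))
      (by fun_prop)
  refine ⟨⟨_, hcont (F := fun z => Complex.cos (‖q.im‖ * Complex.log z))
      (fun z => (norm_sin_cos_log_le q (him z)).2) fun z hz => ?_⟩,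
    ⟨_, hcont (F := fun z => Complex.sin (‖q.im‖ * Complex.log z) / ‖q.im‖)
      (C := Real.exp (‖q.im‖ * Real.pi) / ‖q.im‖) (fun z => ?_) fun z hz => ?_⟩, fun x => ?_⟩
  · have := continuousAt_clog hz
    fun_prop
  · rw [norm_div, Complex.norm_real, norm_norm]
    exact div_le_div_of_nonneg_right (norm_sin_cos_log_le q (him z)).1 (norm_nonneg _)
  · have := continuousAt_clog hz
    exact ContinuousAt.div_const (by fun_prop) _
  · rw [qpow_eq, rotor, smul_add, smul_smul, smul_smul]
    rfl

/-! ### Finite combinations of translates -/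

theorem norm_sq_eq_integral {μ : Measure ℝ} (f : Lp HC 2 μ) : ‖f‖ ^ 2 = ∫ x, ‖f x‖ ^ 2 ∂μ := by
  have h : ((‖f‖ ^ 2 : ℝ) : ℂ) = ((∫ x, ‖f x‖ ^ 2 ∂μ : ℝ) : ℂ) := by
    rw [← integral_complex_ofReal]
    push_cast
    have h1 := inner_self_eq_norm_sq_to_K (𝕜 := ℂ) f
    simp only [Complex.coe_algebraMap] at h1
    rw [← h1, L2.inner_def]
    congr 1
    ext x
    exact inner_self_eq_norm_sq_to_K (𝕜 := ℂ) (f x)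
  exact_mod_cast h

theorem integrable_norm_sq {μ : Measure ℝ} (f : Lp HC 2 μ) :
    Integrable (fun x => ‖f x‖ ^ 2) μ :=
  (memLp_two_iff_integrable_sq_norm (Lp.aestronglyMeasurable f)).1 (Lp.memLp f)

/-- The trigonometric polynomial with coefficients `c`. -/
def trigPoly (c : ℤ →₀ HC) (ξ : ℝ) : HC := ∑ k ∈ c.support, character k ξ • c k

theorem continuous_trigPoly (c : ℤ →₀ HC) : Continuous (trigPoly c) := by
  unfold trigPoly
  exact continuous_finsetSum _ fun k _ => (character k).continuous.smul continuous_const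

theorem norm_trigPoly_le (c : ℤ →₀ HC) (ξ : ℝ) : ‖trigPoly c ξ‖ ≤ ∑ k ∈ c.support, ‖c k‖ := by
  refine (norm_sum_le _ _).trans (Finset.sum_le_sum fun k _ => ?_)
  rw [norm_smul, character_apply, Circle.norm_coe, one_mul]

theorem character_apply_exp (t ξ : ℝ) :
    character t ξ = Complex.exp (-(2 * Real.pi * t * ξ) * Complex.I) := by
  rw [character_apply, Real.fourierChar_apply]
  congr 1
  push_cast
  ring

theorem integral_character_mul (k l : ℤ) (a : ℝ) :
    ∫ ξ in a..a + 1, conj (character k ξ) * character l ξ = if k = l then 1 else 0 := by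
  have h : ∀ ξ : ℝ, conj (character k ξ) * character l ξ =
      Complex.exp ((2 * Real.pi * (k - l) * Complex.I) * ξ) := fun ξ => by
    rw [character_apply_exp, character_apply_exp, ← Complex.exp_conj, ← Complex.exp_add]
    congr 1
    simp only [map_mul, map_neg, Complex.conj_ofReal, Complex.conj_I, map_ofNat,
      Complex.ofReal_intCast]
    rw [← Complex.ofReal_intCast k, Complex.conj_ofReal]
    ring
  simp only [h]
  split_ifs with hkl
  · simp [hkl]
  · have h0 : (2 * Real.pi * (k - l) * Complex.I : ℂ) ≠ 0 := by
      have : (k : ℂ) - l ≠ 0 := sub_ne_zero.2 (by exact_mod_cast hkl)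
      have hpi : (Real.pi : ℂ) ≠ 0 := Complex.ofReal_ne_zero.2 Real.pi_ne_zero
      exact mul_ne_zero (mul_ne_zero (mul_ne_zero two_ne_zero hpi) this) Complex.I_ne_zero
    rw [integral_exp_mul_complex h0]
    have h1 : Complex.exp (2 * Real.pi * (k - l) * Complex.I * ((a + 1 : ℝ) : ℂ)) =
        Complex.exp (2 * Real.pi * (k - l) * Complex.I * a) := by
      rw [Complex.exp_eq_exp_iff_exists_int]
      refine ⟨k - l, ?_⟩
      push_cast
      ring
    rw [h1, sub_self, zero_div]

/-- Parseval's identity. The free left endpoint allows both the period around `0` and each interval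
`[n, n + 1]`. -/
theorem integral_norm_trigPoly_sq (c : ℤ →₀ HC) (a : ℝ) :
    ∫ ξ in a..a + 1, ‖trigPoly c ξ‖ ^ 2 = ∑ k ∈ c.support, ‖c k‖ ^ 2 := by
  have h : ∀ ξ, ((‖trigPoly c ξ‖ ^ 2 : ℝ) : ℂ) = ∑ k ∈ c.support, ∑ l ∈ c.support,
      (conj (character k ξ) * character l ξ) * inner ℂ (c k) (c l) := fun ξ => by
    have h1 := inner_self_eq_norm_sq_to_K (𝕜 := ℂ) (trigPoly c ξ)
    simp only [Complex.coe_algebraMap] at h1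
    rw [Complex.ofReal_pow, ← h1, trigPoly, sum_inner]
    refine Finset.sum_congr rfl fun k _ => ?_
    rw [inner_sum]
    refine Finset.sum_congr rfl fun l _ => ?_
    rw [inner_smul_left, inner_smul_right]
    ring
  have hi : ∀ k l : ℤ, IntervalIntegrable (fun ξ => (conj (character k ξ) * character l ξ) *
      inner ℂ (c k) (c l)) volume a (a + 1) := fun k l => by
    apply Continuous.intervalIntegrable
    have h1 := (character k).continuous
    have h2 := (character l).continuous
    fun_prop
  have h2 : ((∫ ξ in a..a + 1, ‖trigPoly c ξ‖ ^ 2 : ℝ) : ℂ) =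
      ((∑ k ∈ c.support, ‖c k‖ ^ 2 : ℝ) : ℂ) := by
    rw [← intervalIntegral.integral_ofReal]
    simp only [h]
    have hi' : ∀ k : ℤ, IntervalIntegrable (fun ξ => ∑ l ∈ c.support,
        (conj (character k ξ) * character l ξ) * inner ℂ (c k) (c l)) volume a (a + 1) := fun k => by
      simpa only [Finset.sum_fn] using IntervalIntegrable.sum c.support fun l _ => hi k l
    rw [intervalIntegral.integral_finsetSum (fun k _ => hi' k)]
    push_cast
    refine Finset.sum_congr rfl fun k hk => ?_
    rw [intervalIntegral.integral_finsetSum (fun l _ => hi k l)]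
    simp only [intervalIntegral.integral_mul_const, integral_character_mul, ite_mul, one_mul,
      zero_mul, Finset.sum_ite_eq, if_pos hk]
    exact inner_self_eq_norm_sq_to_K (𝕜 := ℂ) (c k)
  exact_mod_cast h2

theorem integrable_trigPoly_weight (c : ℤ →₀ HC) :
    Integrable (fun ξ : ℝ => ‖trigPoly c ξ‖ ^ 2 * (1 + ξ ^ 2)⁻¹) := by
  refine integrable_inv_one_add_sq.bdd_mul (c := (∑ k ∈ c.support, ‖c k‖) ^ 2)
    ((continuous_trigPoly c).norm.pow 2).aestronglyMeasurable
    (Filter.Eventually.of_forall fun ξ => ?_)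
  rw [Real.norm_of_nonneg (by positivity)]
  exact pow_le_pow_left₀ (norm_nonneg _) (norm_trigPoly_le c ξ) 2

theorem summable_inv_one_add_sq : Summable fun n : ℤ => 3 * (1 + (n : ℝ) ^ 2)⁻¹ := by
  refine Summable.mul_left 3 ?_
  have h : Summable fun n : ℤ => 1 / (n : ℝ) ^ 2 := Real.summable_one_div_int_pow.2 one_lt_two
  refine Summable.of_norm_bounded_eventually h ?_
  filter_upwards [Set.Finite.compl_mem_cofinite (Set.finite_singleton (0 : ℤ))] with n hn
  have hn' : (n : ℝ) ≠ 0 := by exact_mod_cast hn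
  rw [Real.norm_of_nonneg (by positivity), one_div]
  gcongr
  linarith

/-- Cut the line into unit intervals: the weight on `(n, n + 1]` is at most `3/(1 + n²)`, and
Parseval gives the same value on each interval. -/
theorem exists_integral_trigPoly_weight_le : ∃ B : ℝ, 0 < B ∧ ∀ c : ℤ →₀ HC,
    ∫ ξ : ℝ, ‖trigPoly c ξ‖ ^ 2 * (1 + ξ ^ 2)⁻¹ ≤ B * ∑ k ∈ c.support, ‖c k‖ ^ 2 := by
  refine ⟨∑' n : ℤ, 3 * (1 + (n : ℝ) ^ 2)⁻¹,
    summable_inv_one_add_sq.tsum_pos (fun n => by positivity) 0 (by positivity), fun c => ?_⟩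
  have hint := integrable_trigPoly_weight c
  have hs := hasSum_integral_iUnion (μ := volume) (s := fun n : ℤ => Set.Ioc (n : ℝ) (n + 1))
    (f := fun ξ : ℝ => ‖trigPoly c ξ‖ ^ 2 * (1 + ξ ^ 2)⁻¹)
    (fun n => measurableSet_Ioc) (Set.pairwise_disjoint_Ioc_intCast ℝ) hint.integrableOn
  rw [iUnion_Ioc_intCast, setIntegral_univ] at hs
  rw [← hs.tsum_eq, ← tsum_mul_right]
  refine Summable.tsum_le_tsum (fun n => ?_) hs.summable (summable_inv_one_add_sq.mul_right _)
  rw [← integral_norm_trigPoly_sq c n, ← intervalIntegral.integral_of_le (by linarith),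
    ← intervalIntegral.integral_const_mul]
  have hc := continuous_trigPoly c
  refine intervalIntegral.integral_mono_on (by linarith) hint.intervalIntegrable
    (Continuous.intervalIntegrable (by fun_prop) _ _) fun ξ hξ => ?_
  rw [mul_comm]
  gcongr
  -- The `3`: from `|ξ - n| ≤ 1` follows `n² ≤ 2ξ² + 2`, so `1 + n² ≤ 3(1 + ξ²)`.
  rw [← div_eq_mul_inv, inv_eq_one_div, div_le_div_iff₀ (by positivity) (by positivity)]
  nlinarith [hξ.1, hξ.2, sq_nonneg (ξ - n), sq_nonneg (2 * ξ - n), sq_nonneg (ξ + n)]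

/-! ### Fourier transforms of finite combinations, and the Riesz bounds. -/

theorem leftMul_bcfMul (h : ℝ →ᵇ ℂ) (c : HC) (f : L2HC) :
    leftMul c (bcfMul h f) = bcfMul h (leftMul c f) := by
  apply Lp.ext
  filter_upwards [coeFn_leftMul c (bcfMul h f), coeFn_bcfMul h f, coeFn_bcfMul h (leftMul c f),
    coeFn_leftMul c f] with x h1 h2 h3 h4
  rw [h1, h2, h3, h4, mul_smul_comm]

theorem fourier_bspline (q : ℍ[ℝ]) (hq : 1 < q.re) :
    (𝓕 (bspline q hq) : L2HC) =ᵐ[volume] fun ξ => qpow (Xi (2 * Real.pi * ξ)) q := by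
  rw [bspline, FourierTransform.fourier_fourierInv_eq]
  exact (memLp_bsplineHat hq).coeFn_toLp

/-- Finite sums of translates, with coefficients acting from the left. -/
def comb (φ : L2HC) (c : ℤ →₀ HC) : L2HC := ∑ k ∈ c.support, leftMul (c k) (translation k φ)

theorem fourier_comb (q : ℍ[ℝ]) (hq : 1 < q.re) (c : ℤ →₀ HC) :
    (𝓕 (comb (bspline q hq) c) : L2HC) =ᵐ[volume]
      fun ξ => trigPoly c ξ * qpow (Xi (2 * Real.pi * ξ)) q := by
  have h : 𝓕 (comb (bspline q hq) c) =
      ∑ k ∈ c.support, leftMul (c k) (bcfMul (character k) (𝓕 (bspline q hq))) := by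
    change Lp.fourierTransformₗᵢ ℝ HC _ = _
    rw [comb, map_sum]
    refine Finset.sum_congr rfl fun k _ => ?_
    rw [← fourier_translation, ← fourier_leftMul]
    rfl
  rw [h]
  have h1 : ∀ᵐ ξ ∂(volume : Measure ℝ), ∀ k : ℤ,
      (leftMul (c k) (bcfMul (character k) (𝓕 (bspline q hq)))) ξ =
        (character k ξ • c k) * qpow (Xi (2 * Real.pi * ξ)) q := by
    rw [ae_all_iff]
    intro k
    filter_upwards [coeFn_leftMul (c k) (bcfMul (character k) (𝓕 (bspline q hq))),
      coeFn_bcfMul (character k) (𝓕 (bspline q hq)), fourier_bspline q hq] with ξ h1 h2 h3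
    rw [h1, h2, h3, mul_smul_comm, smul_mul_assoc]
  filter_upwards [h1, Lp.coeFn_finsetSum c.support
    (fun k => leftMul (c k) (bcfMul (character k) (𝓕 (bspline q hq))))] with ξ h1 h2
  rw [h2, Finset.sum_apply, trigPoly, Finset.sum_mul]
  exact Finset.sum_congr rfl fun k _ => h1 k

/-- Of the `a` powers of `1/(1 + ξ²)`, one is kept as an integrable weight. The other `a - 1` are
estimated at `R` and provide the decay. -/
theorem norm_Xi_rpow_sq_le {a : ℝ} (ha : 1 < a) {R ξ : ℝ} (hR : 0 ≤ R) (hξ : R ≤ |ξ|) :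
    (‖Xi (2 * Real.pi * ξ)‖ ^ a) ^ 2 ≤
      5 ^ a * ((1 + R ^ 2)⁻¹) ^ (a - 1) * (1 + ξ ^ 2)⁻¹ := by
  have h1 : ‖Xi (2 * Real.pi * ξ)‖ ^ 2 ≤ 5 * (1 + ξ ^ 2)⁻¹ := by
    refine (norm_Xi_sq_le _).trans ?_
    have hpi : 1 ≤ 2 * Real.pi := by linarith [Real.pi_gt_three]
    have : ξ ^ 2 ≤ (2 * Real.pi * ξ) ^ 2 := by
      rw [mul_pow]
      exact le_mul_of_one_le_left (sq_nonneg _) (one_le_pow₀ hpi)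
    gcongr
  have h2 : (1 + ξ ^ 2)⁻¹ ≤ (1 + R ^ 2)⁻¹ := by
    rw [← sq_abs ξ]
    gcongr
  have hpos : 0 < (1 + ξ ^ 2)⁻¹ := by positivity
  calc (‖Xi (2 * Real.pi * ξ)‖ ^ a) ^ 2 = (‖Xi (2 * Real.pi * ξ)‖ ^ 2) ^ a := by
        rw [← Real.rpow_natCast, ← Real.rpow_natCast, ← Real.rpow_mul (norm_nonneg _),
          ← Real.rpow_mul (norm_nonneg _), mul_comm a]
    _ ≤ (5 * (1 + ξ ^ 2)⁻¹) ^ a := Real.rpow_le_rpow (by positivity) h1 (by linarith)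
    _ = 5 ^ a * ((1 + ξ ^ 2)⁻¹) ^ (a - 1) * (1 + ξ ^ 2)⁻¹ := by
        rw [Real.mul_rpow (by norm_num) hpos.le, mul_assoc, ← Real.rpow_add_one hpos.ne',
          sub_add_cancel]
    _ ≤ _ := by
        have := Real.rpow_le_rpow hpos.le h2 (by linarith : 0 ≤ a - 1)
        gcongr

/-- The mass of the Fourier transform of a finite combination of translates is, uniformly,
concentrated near the origin. -/
theorem exists_tail_le (q : ℍ[ℝ]) (hq : 1 < q.re) :
    ∃ B : ℝ, 0 < B ∧ ∀ (c : ℤ →₀ HC) (R : ℝ), 0 ≤ R →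
    ∫ ξ in {ξ : ℝ | R ≤ |ξ|}, ‖(𝓕 (comb (bspline q hq) c) : L2HC) ξ‖ ^ 2 ≤
      B * ((1 + R ^ 2)⁻¹) ^ (q.re - 1) * ∑ k ∈ c.support, ‖c k‖ ^ 2 := by
  obtain ⟨B, hB, H⟩ := exists_integral_trigPoly_weight_le
  obtain ⟨K, hK, HK⟩ := exists_norm_qpow_le q
  refine ⟨K ^ 2 * 5 ^ q.re * B, by positivity, fun c R hR => ?_⟩
  set δ := ((1 + R ^ 2)⁻¹) ^ (q.re - 1) with hδ
  have hδ0 : 0 ≤ δ := by positivity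
  have hm : MeasurableSet {ξ : ℝ | R ≤ |ξ|} := measurableSet_le measurable_const measurable_norm
  have hint := integrable_trigPoly_weight c
  calc ∫ ξ in {ξ : ℝ | R ≤ |ξ|}, ‖(𝓕 (comb (bspline q hq) c) : L2HC) ξ‖ ^ 2
      ≤ ∫ ξ in {ξ : ℝ | R ≤ |ξ|},
          (K ^ 2 * 5 ^ q.re * δ) * (‖trigPoly c ξ‖ ^ 2 * (1 + ξ ^ 2)⁻¹) := by
        refine setIntegral_mono_on_ae (integrable_norm_sq _).integrableOn
          (hint.const_mul _).integrableOn hm ?_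
        filter_upwards [fourier_comb q hq c] with ξ h1 hξ
        rw [h1]
        calc ‖trigPoly c ξ * qpow (Xi (2 * Real.pi * ξ)) q‖ ^ 2
            ≤ (K * ‖trigPoly c ξ‖ * ‖Xi (2 * Real.pi * ξ)‖ ^ q.re) ^ 2 :=
              pow_le_pow_left₀ (norm_nonneg _) (HK _ _) 2
          _ = K ^ 2 * ‖trigPoly c ξ‖ ^ 2 * (‖Xi (2 * Real.pi * ξ)‖ ^ q.re) ^ 2 := by ring
          _ ≤ K ^ 2 * ‖trigPoly c ξ‖ ^ 2 * (5 ^ q.re * δ * (1 + ξ ^ 2)⁻¹) := by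
              gcongr
              exact norm_Xi_rpow_sq_le hq hR hξ
          _ = _ := by ring
    _ ≤ ∫ ξ, (K ^ 2 * 5 ^ q.re * δ) * (‖trigPoly c ξ‖ ^ 2 * (1 + ξ ^ 2)⁻¹) :=
        setIntegral_le_integral (hint.const_mul _)
          (Filter.Eventually.of_forall fun ξ => by positivity)
    _ = (K ^ 2 * 5 ^ q.re * δ) * ∫ ξ, ‖trigPoly c ξ‖ ^ 2 * (1 + ξ ^ 2)⁻¹ := integral_const_mul _ _
    _ ≤ (K ^ 2 * 5 ^ q.re * δ) * (B * ∑ k ∈ c.support, ‖c k‖ ^ 2) := by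
        gcongr
        exact H c
    _ = _ := by ring

theorem exists_comb_norm_le (q : ℍ[ℝ]) (hq : 1 < q.re) : ∃ B : ℝ, 0 < B ∧ ∀ c : ℤ →₀ HC,
    ‖comb (bspline q hq) c‖ ^ 2 ≤ B * ∑ k ∈ c.support, ‖c k‖ ^ 2 := by
  obtain ⟨B, hB, H⟩ := exists_tail_le q hq
  refine ⟨B, hB, fun c => ?_⟩
  -- With `R = 0` the tail is the whole line and the decay factor is `1`.
  have h := H c 0 le_rfl
  simp only [abs_nonneg, Set.ofPred_true, setIntegral_univ] at h
  rw [← norm_sq_eq_integral, Lp.norm_fourier_eq] at h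
  simpa using h

/-- One period suffices: for `|ξ| ≤ 1/2` the argument `2πξ` stays in `[-π, π]`, where `|Ξ| ≥ 2/π`.
-/
theorem exists_le_comb_norm (q : ℍ[ℝ]) (hq : 1 < q.re) : ∃ A : ℝ, 0 < A ∧ ∀ c : ℤ →₀ HC,
    A * ∑ k ∈ c.support, ‖c k‖ ^ 2 ≤ ‖comb (bspline q hq) c‖ ^ 2 := by
  obtain ⟨K, hK, HK⟩ := exists_le_norm_qpow q
  have hpi := Real.pi_pos
  set m := ((2 / Real.pi) ^ q.re / K) ^ 2 with hm
  refine ⟨m, by positivity, fun c => ?_⟩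
  have hle : (-(1 / 2) : ℝ) ≤ -(1 / 2) + 1 := by norm_num
  rw [← Lp.norm_fourier_eq, norm_sq_eq_integral, ← integral_norm_trigPoly_sq c (-(1 / 2)),
    intervalIntegral.integral_of_le hle, ← integral_const_mul]
  refine le_trans ?_ (setIntegral_le_integral (s := Set.Ioc (-(1 / 2) : ℝ) (-(1 / 2) + 1))
    (integrable_norm_sq _) (Filter.Eventually.of_forall fun ξ => by positivity))
  have hc := continuous_trigPoly c
  refine setIntegral_mono_on_ae ?_ (integrable_norm_sq _).integrableOn measurableSet_Ioc ?_
  · exact (intervalIntegrable_iff_integrableOn_Ioc_of_le hle).1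
      (Continuous.intervalIntegrable (by fun_prop) _ _)
  filter_upwards [fourier_comb q hq c] with ξ h1 hξ
  rw [h1, hm, ← mul_pow]
  refine pow_le_pow_left₀ (by positivity) ?_ 2
  rw [div_mul_eq_mul_div, div_le_iff₀ hK, mul_comm _ K]
  refine le_trans ?_ (HK _ _)
  gcongr
  apply two_div_pi_le_norm_Xi
  rw [abs_mul, abs_of_pos (by positivity)]
  have : |ξ| ≤ 1 / 2 := abs_le.2 ⟨hξ.1.le, by linarith [hξ.2]⟩
  nlinarith

/-! ### Closed left spans -/

theorem leftMul_leftMul (c d : HC) (f : L2HC) : leftMul c (leftMul d f) = leftMul (c * d) f := by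
  apply Lp.ext
  filter_upwards [coeFn_leftMul c (leftMul d f), coeFn_leftMul d f, coeFn_leftMul (c * d) f]
    with x h1 h2 h3
  rw [h1, h2, h3, mul_assoc]

theorem leftMul_one (f : L2HC) : leftMul 1 f = f := by
  apply Lp.ext
  filter_upwards [coeFn_leftMul 1 f] with x h1
  rw [h1, one_mul]

theorem leftMul_add (c d : HC) (f : L2HC) : leftMul (c + d) f = leftMul c f + leftMul d f := by
  apply Lp.ext
  filter_upwards [coeFn_leftMul c f, coeFn_leftMul d f, coeFn_leftMul (c + d) f,
    Lp.coeFn_add (leftMul c f) (leftMul d f)] with x h1 h2 h3 h4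
  rw [h3, h4, Pi.add_apply, h1, h2, add_mul]

theorem leftMul_smul (a : ℂ) (c : HC) (f : L2HC) : leftMul (a • c) f = a • leftMul c f := by
  apply Lp.ext
  filter_upwards [coeFn_leftMul c f, coeFn_leftMul (a • c) f, Lp.coeFn_smul a (leftMul c f)]
    with x h1 h2 h3
  rw [h2, h3, Pi.smul_apply, h1, smul_mul_assoc]

theorem isClosed_closedLeftSpan (S : Set L2HC) : IsClosed (closedLeftSpan S : Set L2HC) :=
  Submodule.isClosed_topologicalClosure _

theorem leftMul_mem_closedLeftSpan_of_mem {S : Set L2HC} {f : L2HC} (hf : f ∈ S) (c : HC) :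
    leftMul c f ∈ closedLeftSpan S :=
  Submodule.le_topologicalClosure _ (Submodule.subset_span ⟨c, f, hf, rfl⟩)

theorem subset_closedLeftSpan (S : Set L2HC) : S ⊆ closedLeftSpan S := fun f hf => by
  simpa [leftMul_one] using leftMul_mem_closedLeftSpan_of_mem hf 1

theorem closedLeftSpan_le {S : Set L2HC} {W : Submodule ℂ L2HC} (hW : IsClosed (W : Set L2HC))
    (h : ∀ c : HC, ∀ f ∈ S, leftMul c f ∈ W) : closedLeftSpan S ≤ W := by
  refine Submodule.topologicalClosure_minimal _ (Submodule.span_le.2 ?_) hW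
  rintro _ ⟨c, f, hf, rfl⟩
  exact h c f hf

theorem leftMul_mem_closedLeftSpan {S : Set L2HC} (c : HC) {f : L2HC}
    (hf : f ∈ closedLeftSpan S) : leftMul c f ∈ closedLeftSpan S := by
  have h : closedLeftSpan S ≤ (closedLeftSpan S).comap (leftMul c).toLinearMap :=
    closedLeftSpan_le ((isClosed_closedLeftSpan S).preimage (leftMul c).continuous) fun d f hf => by
      rw [Submodule.mem_comap, ContinuousLinearMap.coe_coe, leftMul_leftMul]
      exact leftMul_mem_closedLeftSpan_of_mem hf _
  exact h hf

theorem map_mem_closedLeftSpan {S S' : Set L2HC} (A : L2HC →ₗᵢ[ℂ] L2HC)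
    (hA : ∀ c f, A (leftMul c f) = leftMul c (A f)) (hS : ∀ f ∈ S, A f ∈ closedLeftSpan S')
    {f : L2HC} (hf : f ∈ closedLeftSpan S) : A f ∈ closedLeftSpan S' := by
  have h : closedLeftSpan S ≤ (closedLeftSpan S').comap A.toLinearMap :=
    closedLeftSpan_le ((isClosed_closedLeftSpan S').preimage A.continuous) fun c f hf => by
      rw [Submodule.mem_comap, LinearIsometry.coe_toLinearMap, hA]
      exact leftMul_mem_closedLeftSpan c (hS f hf)
  exact h hf

/-! ### Commutation relations -/

theorem translation_leftMul (t : ℝ) (c : HC) (f : L2HC) :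
    translation t (leftMul c f) = leftMul c (translation t f) := by
  apply Lp.ext
  filter_upwards [coeFn_translation t (leftMul c f), coeFn_leftMul c (translation t f),
    coeFn_translation t f, (measurePreserving_sub_right volume t).quasiMeasurePreserving.ae
      (coeFn_leftMul c f)] with x h1 h2 h3 h4
  rw [h1, h2, h3, h4]

theorem translation_translation (s t : ℝ) (f : L2HC) :
    translation s (translation t f) = translation (s + t) f := by
  apply Lp.ext
  filter_upwards [coeFn_translation s (translation t f), coeFn_translation (s + t) f,
    (measurePreserving_sub_right volume s).quasiMeasurePreserving.ae
      (coeFn_translation t f)] with x h1 h2 h3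
  rw [h1, h2, h3, sub_sub]

theorem translation_zero (f : L2HC) : translation 0 f = f := by
  apply Lp.ext
  filter_upwards [coeFn_translation 0 f] with x h1
  rw [h1, sub_zero]

theorem dilation_leftMul (c : HC) (f : L2HC) :
    dilation (leftMul c f) = leftMul c (dilation f) := by
  apply Lp.ext
  filter_upwards [coeFn_dilation (leftMul c f), coeFn_leftMul c (dilation f), coeFn_dilation f,
    ae_scale two_pos (coeFn_leftMul c f)] with x h1 h2 h3 h4
  rw [h1, h2, h3, h4, mul_smul_comm]

theorem dilation_translation (t : ℝ) (f : L2HC) :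
    dilation (translation (2 * t) f) = translation t (dilation f) := by
  apply Lp.ext
  filter_upwards [coeFn_dilation (translation (2 * t) f), coeFn_translation t (dilation f),
    (measurePreserving_sub_right volume t).quasiMeasurePreserving.ae (coeFn_dilation f),
    ae_scale two_pos (coeFn_translation (2 * t) f)] with x h1 h2 h3 h4
  rw [h1, h2, h3, h4, mul_sub]

theorem dilation_zpow_add_apply (m n : ℤ) (f : L2HC) :
    (dilation ^ (m + n)) f = (dilation ^ m) ((dilation ^ n) f) := by
  rw [zpow_add]
  rfl

theorem dilation_zpow_leftMul (n : ℤ) (c : HC) (f : L2HC) :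
    (dilation ^ n) (leftMul c f) = leftMul c ((dilation ^ n) f) := by
  induction n generalizing f with
  | zero => rfl
  | succ n ih =>
    rw [dilation_zpow_add_apply, dilation_zpow_add_apply, zpow_one, dilation_leftMul, ih]
  | pred n ih =>
    rw [sub_eq_add_neg, dilation_zpow_add_apply, dilation_zpow_add_apply]
    have h : ∀ f, (dilation ^ (-1 : ℤ)) (leftMul c f) = leftMul c ((dilation ^ (-1 : ℤ)) f) := by
      intro f
      rw [zpow_neg_one]
      change dilation.symm _ = leftMul c (dilation.symm f)
      rw [LinearIsometryEquiv.symm_apply_eq, dilation_leftMul, LinearIsometryEquiv.apply_symm_apply]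
    rw [h, ih]

theorem dilation_pow_translation (n : ℕ) (t : ℝ) (f : L2HC) :
    (dilation ^ (n : ℤ)) (translation (2 ^ n * t) f) = translation t ((dilation ^ (n : ℤ)) f) := by
  induction n generalizing f with
  | zero => simp
  | succ n ih =>
    push_cast
    rw [dilation_zpow_add_apply, dilation_zpow_add_apply, zpow_one, ← ih, ← dilation_translation]
    congr 3
    ring_nf

/-! ### The spline spaces -/

theorem dilation_zpow_mem {q : ℍ[ℝ]} {hq : 1 < q.re} (m : ℤ) {n : ℤ} {f : L2HC}
    (hf : f ∈ splineSpace q hq n) : (dilation ^ m) f ∈ splineSpace q hq (m + n) := by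
  refine map_mem_closedLeftSpan (dilation ^ m).toLinearIsometry (dilation_zpow_leftMul m) ?_ hf
  rintro _ ⟨k, rfl⟩
  refine subset_closedLeftSpan _ ⟨k, ?_⟩
  exact dilation_zpow_add_apply _ _ _

theorem dilation_zpow_mem_iff {q : ℍ[ℝ]} {hq : 1 < q.re} (m n : ℤ) (f : L2HC) :
    (dilation ^ m) f ∈ splineSpace q hq (m + n) ↔ f ∈ splineSpace q hq n := by
  refine ⟨fun h => ?_, dilation_zpow_mem m⟩
  have := dilation_zpow_mem (-m) h
  rwa [← dilation_zpow_add_apply, neg_add_cancel, neg_add_cancel_left, zpow_zero] at this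

theorem dilation_mem_iff {q : ℍ[ℝ]} {hq : 1 < q.re} (n : ℤ) (f : L2HC) :
    dilation f ∈ splineSpace q hq (n + 1) ↔ f ∈ splineSpace q hq n := by
  have := dilation_zpow_mem_iff (q := q) (hq := hq) 1 n f
  rwa [zpow_one, add_comm] at this

theorem splineSpace_zero (q : ℍ[ℝ]) (hq : 1 < q.re) :
    splineSpace q hq 0 = closedLeftSpan (Set.range fun k : ℤ => translation k (bspline q hq)) :=
  rfl

theorem translation_bspline_mem (q : ℍ[ℝ]) (hq : 1 < q.re) (k : ℤ) :
    translation k (bspline q hq) ∈ splineSpace q hq 0 := by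
  rw [splineSpace_zero]
  exact subset_closedLeftSpan _ ⟨k, rfl⟩

theorem translation_mem {q : ℍ[ℝ]} {hq : 1 < q.re} (k : ℤ) {f : L2HC}
    (hf : f ∈ splineSpace q hq 0) : translation k f ∈ splineSpace q hq 0 := by
  rw [splineSpace_zero] at hf ⊢
  refine map_mem_closedLeftSpan (translation k) (translation_leftMul k) ?_ hf
  rintro _ ⟨l, rfl⟩
  refine subset_closedLeftSpan _ ⟨k + l, ?_⟩
  simp only [translation_translation]
  push_cast
  rfl

theorem translation_mem_iff {q : ℍ[ℝ]} {hq : 1 < q.re} (k : ℤ) (f : L2HC) :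
    translation k f ∈ splineSpace q hq 0 ↔ f ∈ splineSpace q hq 0 := by
  refine ⟨fun h => ?_, translation_mem k⟩
  have := translation_mem (-k) h
  rwa [translation_translation, Int.cast_neg, neg_add_cancel, translation_zero] at this

/-! ### The two-scale relation -/

/-- The lift of a continuous function on the circle to a periodic function on the line. -/
def periodicLift (h : C(UnitAddCircle, ℂ)) : ℝ →ᵇ ℂ :=
  (BoundedContinuousFunction.mkOfCompact h).compContinuous
    ⟨fun x : ℝ => (x : UnitAddCircle), AddCircle.continuous_mk' 1⟩

theorem periodicLift_apply (h : C(UnitAddCircle, ℂ)) (x : ℝ) :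
    periodicLift h x = h (x : UnitAddCircle) := rfl

/-- Multiplication of a fixed function by periodic functions. -/
def periodicMul (f : L2HC) : C(UnitAddCircle, ℂ) →L[ℂ] L2HC :=
  LinearMap.mkContinuous
    { toFun := fun h => bcfMul (periodicLift h) f
      map_add' := fun h₁ h₂ => by
        rw [← add_apply, ← map_add]
        rfl
      map_smul' := fun c h => by
        rw [RingHom.id_apply, ← smul_apply, ← map_smul]
        rfl } ‖f‖ fun h => by
    refine Lp.norm_le_mul_norm_of_ae_le_mul (c := ‖h‖) ?_ |>.trans_eq (mul_comm _ _)
    filter_upwards [coeFn_bcfMul (periodicLift h) f] with x e1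
    rw [LinearMap.coe_mk, AddHom.coe_mk, e1, norm_smul]
    exact mul_le_mul_of_nonneg_right (h.norm_coe_le_norm _) (norm_nonneg _)

/-- Multiplying `f̂` by a character of the circle translates `f` by an integer, which preserves
`V_0`. Trigonometric polynomials are uniformly dense and `V_0` is closed. -/
theorem fourierInv_periodicMul_mem {q : ℍ[ℝ]} {hq : 1 < q.re} {f : L2HC}
    (hf : f ∈ splineSpace q hq 0) (h : C(UnitAddCircle, ℂ)) :
    (𝓕⁻ (periodicMul (𝓕 f) h) : L2HC) ∈ splineSpace q hq 0 := by
  let A : C(UnitAddCircle, ℂ) →L[ℂ] L2HC :=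
    (Lp.fourierTransformₗᵢ ℝ HC).symm.toContinuousLinearEquiv.toContinuousLinearMap ∘L
      periodicMul (𝓕 f)
  have h1 : (Submodule.span ℂ (Set.range (@fourier 1))).topologicalClosure ≤
      (splineSpace q hq 0).comap A.toLinearMap := by
    refine Submodule.topologicalClosure_minimal _ (Submodule.span_le.2 ?_)
      ((isClosed_closedLeftSpan _).preimage A.continuous)
    rintro _ ⟨k, rfl⟩
    change (𝓕⁻ (bcfMul (periodicLift (fourier k)) (𝓕 f)) : L2HC) ∈ splineSpace q hq 0
    have h2 : periodicLift (fourier k) = character ((-k : ℤ) : ℝ) := by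
      ext ξ
      rw [periodicLift_apply, fourier_coe_apply, character_apply_exp]
      congr 1
      push_cast
      ring
    rw [h2, ← fourier_translation, FourierTransform.fourierInv_fourier_eq]
    exact translation_mem _ hf
  rw [span_fourier_closure_eq_top] at h1
  exact h1 (Submodule.mem_top (x := h))

theorem ae_sin_two_pi_ne_zero : ∀ᵐ ξ : ℝ, Real.sin (2 * Real.pi * ξ) ≠ 0 := by
  have hc : (Set.range fun n : ℤ => (n : ℝ) / 2).Countable := Set.countable_range _
  filter_upwards [hc.ae_notMem volume] with ξ hξ h
  obtain ⟨n, hn⟩ := Real.sin_eq_zero_iff.1 h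
  apply hξ
  refine ⟨n, ?_⟩
  have hpi := Real.pi_pos
  field_simp at hn ⊢
  linarith

/-- The two-scale relation: the transform of `D⁻¹ B_q` is `√2 Ξ(4πξ)^q`, that is `√2 (h₁ + h₂ v)`
times the transform of `B_q`. The `h_i` are periodic multipliers and `v` is a left coefficient, so
both operations stay in `V_0`. -/
theorem dilation_symm_bspline_mem (q : ℍ[ℝ]) (hq : 1 < q.re) :
    dilation.symm (bspline q hq) ∈ splineSpace q hq 0 := by
  obtain ⟨h₁, h₂, H⟩ := exists_symbol (q := q) (by linarith)
  set B := bspline q hq with hB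
  have hBmem : B ∈ splineSpace q hq 0 := by
    have := translation_bspline_mem q hq 0
    rwa [Int.cast_zero, translation_zero] at this
  have key : dilation.symm B = ((√2 : ℝ) : ℂ) • ((𝓕⁻ (periodicMul (𝓕 B) h₁) : L2HC) +
      leftMul (complexify q.im) (𝓕⁻ (periodicMul (𝓕 B) h₂))) := by
    apply (Lp.fourierTransformₗᵢ ℝ HC).injective
    rw [map_smul, map_add]
    change (𝓕 (dilation.symm B) : L2HC) = ((√2 : ℝ) : ℂ) • ((𝓕 (𝓕⁻ (periodicMul (𝓕 B) h₁)) : L2HC) +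
      𝓕 (leftMul (complexify q.im) (𝓕⁻ (periodicMul (𝓕 B) h₂))))
    have h3 : (𝓕 (dilation.symm B) : L2HC) = dilation (𝓕 B) := by
      have := fourier_dilation (dilation.symm B)
      rw [LinearIsometryEquiv.apply_symm_apply] at this
      rw [this, LinearIsometryEquiv.apply_symm_apply]
    rw [h3, fourier_leftMul, FourierTransform.fourier_fourierInv_eq,
      FourierTransform.fourier_fourierInv_eq]
    apply Lp.ext
    set P₁ := periodicMul (𝓕 B) h₁ with hP₁
    set P₂ := periodicMul (𝓕 B) h₂ with hP₂
    filter_upwards [coeFn_dilation (𝓕 B), ae_scale two_pos (fourier_bspline q hq),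
      fourier_bspline q hq, Lp.coeFn_smul ((√2 : ℝ) : ℂ) (P₁ + leftMul (complexify q.im) P₂),
      Lp.coeFn_add P₁ (leftMul (complexify q.im) P₂), coeFn_leftMul (complexify q.im) P₂,
      coeFn_bcfMul (periodicLift h₁) (𝓕 B), coeFn_bcfMul (periodicLift h₂) (𝓕 B),
      ae_sin_two_pi_ne_zero] with ξ e1 e2 e3 e4 e5 e6 e7 e8 e9
    have e7' : P₁ ξ = h₁ ξ • (𝓕 B : L2HC) ξ := e7
    have e8' : P₂ ξ = h₂ ξ • (𝓕 B : L2HC) ξ := e8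
    rw [e1, e4, Pi.smul_apply, e5, Pi.add_apply, e6, e7', e8', hB, e2, e3]
    congr 1
    have hw : (1 + Complex.exp (-Complex.I * ((2 * Real.pi * ξ : ℝ) : ℂ))) / 2 =
        (1 + fourier (-1) (ξ : UnitAddCircle)) / 2 := by
      rw [fourier_coe_apply]
      congr 3
      push_cast
      ring
    have h4 := qpow_Xi_two_mul e9 q
    rw [hw, H ξ] at h4
    rw [show 2 * Real.pi * (2 * ξ) = 2 * (2 * Real.pi * ξ) by ring, h4, add_mul, smul_mul_assoc,
      smul_mul_assoc, one_mul, mul_smul_comm]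
  rw [key]
  exact Submodule.smul_mem _ _ (Submodule.add_mem _ (fourierInv_periodicMul_mem hBmem _)
    (leftMul_mem_closedLeftSpan _ (fourierInv_periodicMul_mem hBmem _)))

theorem splineSpace_le_succ (q : ℍ[ℝ]) (hq : 1 < q.re) (n : ℤ) :
    splineSpace q hq n ≤ splineSpace q hq (n + 1) := by
  have h1 : ∀ k : ℤ, translation k (bspline q hq) ∈ splineSpace q hq 1 := by
    intro k
    -- `T_k = D T_{2k} D⁻¹` reduces every translate to the two-scale relation.
    have h2 : translation k (bspline q hq) =
        dilation (translation ((2 * k : ℤ) : ℝ) (dilation.symm (bspline q hq))) := by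
      push_cast
      rw [dilation_translation, LinearIsometryEquiv.apply_symm_apply]
    rw [h2, ← zero_add (1 : ℤ), dilation_mem_iff]
    exact translation_mem _ (dilation_symm_bspline_mem q hq)
  refine closedLeftSpan_le (isClosed_closedLeftSpan _) ?_
  rintro c _ ⟨k, rfl⟩
  exact leftMul_mem_closedLeftSpan c (dilation_zpow_mem n (h1 k))

/-! ### The intersection of the spline spaces -/

/-- The mass of `f` at distance at least `R` from the origin. -/
def tailMass (R : ℝ) (f : L2HC) : ℝ := ∫ ξ in {ξ : ℝ | R ≤ |ξ|}, ‖f ξ‖ ^ 2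

theorem measurableSet_tail (R : ℝ) : MeasurableSet {ξ : ℝ | R ≤ |ξ|} :=
  measurableSet_le measurable_const measurable_norm

theorem continuous_tailMass (R : ℝ) : Continuous (tailMass R) := by
  have h : tailMass R = fun f =>
      ‖LpToLpRestrictCLM ℝ HC ℂ volume 2 {ξ : ℝ | R ≤ |ξ|} f‖ ^ 2 := by
    ext f
    rw [norm_sq_eq_integral]
    refine integral_congr_ae ?_
    filter_upwards [LpToLpRestrictCLM_coeFn ℂ {ξ : ℝ | R ≤ |ξ|} f] with ξ h1
    rw [h1]
  rw [h]
  exact ((LpToLpRestrictCLM ℝ HC ℂ volume 2 _).continuous.norm).pow 2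

theorem tailMass_nonneg (R : ℝ) (f : L2HC) : 0 ≤ tailMass R f :=
  integral_nonneg fun _ => by positivity

theorem tailMass_dilation_symm (R : ℝ) (f : L2HC) :
    tailMass (2 * R) (dilation.symm f) = tailMass R f := by
  rw [tailMass, tailMass, ← integral_indicator (measurableSet_tail _),
    ← integral_indicator (measurableSet_tail _)]
  have h := Measure.integral_comp_mul_left
    (fun ξ => ({ξ : ℝ | R ≤ |ξ|}.indicator (fun ξ => ‖f ξ‖ ^ 2) ξ)) (2⁻¹ : ℝ)
  rw [inv_inv, abs_two, smul_eq_mul] at h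
  have h2 : ∫ ξ, {ξ : ℝ | 2 * R ≤ |ξ|}.indicator (fun ξ => ‖dilation.symm f ξ‖ ^ 2) ξ =
      ∫ ξ, 2⁻¹ * {ξ : ℝ | R ≤ |ξ|}.indicator (fun ξ => ‖f ξ‖ ^ 2) (2⁻¹ * ξ) := by
    refine integral_congr_ae ?_
    filter_upwards [coeFn_dilation_symm f] with ξ h1
    have hiff : R ≤ |2⁻¹ * ξ| ↔ 2 * R ≤ |ξ| := by
      rw [abs_mul, abs_of_pos (by norm_num : (0 : ℝ) < 2⁻¹)]
      constructor <;> intro h <;> linarith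
    by_cases hξ : 2 * R ≤ |ξ|
    · rw [Set.indicator_of_mem (show ξ ∈ {ξ : ℝ | 2 * R ≤ |ξ|} from hξ),
        Set.indicator_of_mem (show 2⁻¹ * ξ ∈ {ξ : ℝ | R ≤ |ξ|} from hiff.2 hξ), h1, norm_smul,
        mul_pow, Complex.norm_real, Real.norm_of_nonneg (by positivity), Real.sq_sqrt (by norm_num)]
    · rw [Set.indicator_of_notMem (show ξ ∉ {ξ : ℝ | 2 * R ≤ |ξ|} from hξ),
        Set.indicator_of_notMem (show 2⁻¹ * ξ ∉ {ξ : ℝ | R ≤ |ξ|} from fun h => hξ (hiff.1 h)),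
        mul_zero]
  rw [h2, integral_const_mul, h]
  ring

/-- Each dilation doubles all frequencies and preserves mass. -/
theorem tailMass_fourier_dilation_pow (n : ℕ) (R : ℝ) (f : L2HC) :
    tailMass (2 ^ n * R) (𝓕 ((dilation ^ (n : ℤ)) f)) = tailMass R (𝓕 f) := by
  induction n with
  | zero => simp
  | succ n ih =>
    push_cast
    rw [add_comm (n : ℤ), dilation_zpow_add_apply, zpow_one, fourier_dilation, pow_succ',
      mul_assoc, tailMass_dilation_symm, ih]

/-- The finite combinations of translates, as a linear function of the coefficients. -/
def combLinear (φ : L2HC) : (ℤ →₀ HC) →ₗ[ℂ] L2HC :=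
  Finsupp.lsum ℂ fun k : ℤ =>
    { toFun := fun c => leftMul c (translation k φ)
      map_add' := fun c d => leftMul_add c d _
      map_smul' := fun a c => leftMul_smul a c _ }

/-- The lower Riesz bound eliminates the coefficients from the tail estimate for finite
combinations. What remains is a closed condition on `f`, so it passes to the closure. -/
theorem exists_tailMass_fourier_le (q : ℍ[ℝ]) (hq : 1 < q.re) : ∃ M : ℝ, 0 < M ∧
    ∀ f ∈ splineSpace q hq 0, ∀ R, 0 ≤ R →
      tailMass R (𝓕 f) ≤ M * ((1 + R ^ 2)⁻¹) ^ (q.re - 1) * ‖f‖ ^ 2 := by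
  obtain ⟨A, hA, HA⟩ := exists_le_comb_norm q hq
  obtain ⟨B, hB, HB⟩ := exists_tail_le q hq
  refine ⟨B / A, by positivity, fun f hf R hR => ?_⟩
  set δ := ((1 + R ^ 2)⁻¹) ^ (q.re - 1) with hδ
  have hδ0 : 0 ≤ δ := by positivity
  have hclosed : IsClosed {f : L2HC | tailMass R (𝓕 f) ≤ B / A * δ * ‖f‖ ^ 2} :=
    isClosed_le ((continuous_tailMass R).comp continuous_fourier_L2HC) (by fun_prop)
  have hcomb : ∀ c : ℤ →₀ HC, comb (bspline q hq) c ∈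
      {f : L2HC | tailMass R (𝓕 f) ≤ B / A * δ * ‖f‖ ^ 2} := by
    intro c
    refine (HB c R hR).trans ?_
    have h1 : ∑ k ∈ c.support, ‖c k‖ ^ 2 ≤ ‖comb (bspline q hq) c‖ ^ 2 / A := by
      rw [le_div_iff₀ hA, mul_comm]
      exact HA c
    calc B * δ * ∑ k ∈ c.support, ‖c k‖ ^ 2
        ≤ B * δ * (‖comb (bspline q hq) c‖ ^ 2 / A) := by gcongr
      _ = _ := by ring
  have hspan : (Submodule.span ℂ {g : L2HC | ∃ c : HC, ∃ f ∈ Set.range fun k : ℤ =>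
      translation k (bspline q hq), g = leftMul c f}) ≤ LinearMap.range (combLinear (bspline q hq)) := by
    refine Submodule.span_le.2 ?_
    rintro _ ⟨c, _, ⟨k, rfl⟩, rfl⟩
    exact ⟨Finsupp.single k c, Finsupp.lsum_single _ _ _ _⟩
  rw [splineSpace_zero] at hf
  refine closure_minimal ?_ hclosed hf
  intro g hg
  obtain ⟨c, rfl⟩ := hspan hg
  exact hcomb c

theorem iInter_splineSpace (q : ℍ[ℝ]) (hq : 1 < q.re) :
    ⋂ n, (splineSpace q hq n : Set L2HC) = {0} := by
  refine Set.eq_singleton_iff_unique_mem.2 ⟨Set.mem_iInter.2 fun n => Submodule.zero_mem _, ?_⟩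
  intro f hf
  obtain ⟨M, hM, H⟩ := exists_tailMass_fourier_le q hq
  have htail : ∀ ε : ℝ, 0 < ε → tailMass ε (𝓕 f) = 0 := by
    intro ε hε
    refine le_antisymm ?_ (tailMass_nonneg _ _)
    -- As `f ∈ V_{-n}`, the function `D^n f` is in `V_0`. The mass of `f̂` beyond `ε` is that of its
    -- transform beyond `2^n ε`.
    have hle : ∀ n : ℕ, tailMass ε (𝓕 f) ≤
        M * ((1 + (2 ^ n * ε) ^ 2)⁻¹) ^ (q.re - 1) * ‖f‖ ^ 2 := by
      intro n
      rw [← tailMass_fourier_dilation_pow n]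
      refine (H _ ?_ _ (by positivity)).trans_eq (by rw [LinearIsometryEquiv.norm_map])
      have := dilation_zpow_mem n (Set.mem_iInter.1 hf (-(n : ℤ)))
      rwa [add_neg_cancel] at this
    have hlim : Filter.Tendsto (fun n : ℕ =>
        M * ((1 + ((2 : ℝ) ^ n * ε) ^ 2)⁻¹) ^ (q.re - 1) * ‖f‖ ^ 2) Filter.atTop (nhds 0) := by
      have h1 : Filter.Tendsto (fun n : ℕ => 1 + ((2 : ℝ) ^ n * ε) ^ 2) Filter.atTop
          Filter.atTop :=
        Filter.tendsto_atTop_add_const_left _ _ ((Filter.tendsto_pow_atTop two_ne_zero).comp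
          ((tendsto_pow_atTop_atTop_of_one_lt one_lt_two).atTop_mul_const hε))
      have h2 := h1.inv_tendsto_atTop.rpow_const (p := q.re - 1) (Or.inr (by linarith))
      rw [Real.zero_rpow (by linarith)] at h2
      simpa using (h2.const_mul M).mul_const (‖f‖ ^ 2)
    exact ge_of_tendsto' hlim hle
  have hae : ∀ᵐ ξ : ℝ, ∀ n : ℕ, 1 / ((n : ℝ) + 1) ≤ |ξ| → (𝓕 f : L2HC) ξ = 0 := by
    rw [ae_all_iff]
    intro n
    have h := htail (1 / ((n : ℝ) + 1)) (by positivity)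
    rw [tailMass, integral_eq_zero_iff_of_nonneg (fun _ => by positivity)
      (integrable_norm_sq _).integrableOn] at h
    have h' := (ae_restrict_iff' (measurableSet_tail _)).1 h
    filter_upwards [h'] with ξ h1 h2
    have h3 : ‖(𝓕 f : L2HC) ξ‖ ^ 2 = 0 := h1 h2
    exact norm_eq_zero.1 (pow_eq_zero_iff two_ne_zero |>.1 h3)
  have hzero : (𝓕 f : L2HC) = 0 := by
    apply Lp.ext
    filter_upwards [hae, Lp.coeFn_zero HC 2 (volume : Measure ℝ),
      (Set.countable_singleton (0 : ℝ)).ae_notMem volume] with ξ h1 h2 h3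
    obtain ⟨n, hn⟩ := exists_nat_one_div_lt (abs_pos.2 h3)
    rw [h1 n hn.le, h2]
    rfl
  rw [← norm_eq_zero, ← Lp.norm_fourier_eq, hzero, norm_zero]

/-! ### The union of the spline spaces -/

/-- An integrable function whose Fourier transform vanishes is zero almost everywhere. -/
theorem ae_eq_zero_of_fourier_eq_zero {G : ℝ → ℂ} (hG : Integrable G) (h : 𝓕 G = 0) :
    ∀ᵐ x, G x = 0 := by
  refine ae_eq_zero_of_integral_contDiff_smul_eq_zero hG.locallyIntegrable fun g hg hgs => ?_
  have hs : HasCompactSupport fun x => (g x : ℂ) :=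
    hgs.comp_left (g := fun x : ℝ => (x : ℂ)) Complex.ofReal_zero
  let φ : 𝓢(ℝ, ℂ) := hs.toSchwartzMap (Complex.ofRealCLM.contDiff.comp hg)
  have hφ : ∀ x, φ x = (g x : ℂ) := fun x => rfl
  -- Moving the transform across the integral: `∫ φ G = ∫ 𝓕(𝓕⁻ φ) G = ∫ (𝓕⁻ φ) 𝓕 G = 0`.
  have h1 := VectorFourier.integral_fourierIntegral_smul_eq_flip (L := innerₗ ℝ)
    (μ := volume) (ν := volume) Real.continuous_fourierChar
    (by exact continuous_inner) ((𝓕⁻ φ : 𝓢(ℝ, ℂ)).integrable (μ := volume)) hG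
  have h2 : ∀ ξ, VectorFourier.fourierIntegral Real.fourierChar volume (innerₗ ℝ)
      (𝓕⁻ φ : 𝓢(ℝ, ℂ)) ξ = φ ξ := by
    intro ξ
    have h3 : 𝓕 (𝓕⁻ φ : 𝓢(ℝ, ℂ)) = φ := FourierTransform.fourier_fourierInv_eq φ
    conv_rhs => rw [← h3]
    rfl
  have h4 : ∀ x, VectorFourier.fourierIntegral Real.fourierChar volume (innerₗ ℝ).flip G x = 0 := by
    intro x
    rw [flip_innerₗ]
    exact congrFun h x
  simp only [h2, h4, smul_zero, integral_zero] at h1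
  simpa only [hφ, Complex.coe_smul] using h1

/-- `T_{k/2^n} = D^n T_k D^{-n}`, and `D^{-n} B_q` is in `V_0` because `B_q ∈ V_0 ⊆ V_n`. -/
theorem translation_dyadic_mem (q : ℍ[ℝ]) (hq : 1 < q.re) (n : ℕ) (k : ℤ) :
    translation (k / 2 ^ n) (bspline q hq) ∈ splineSpace q hq n := by
  have hmono : Monotone (splineSpace q hq) := monotone_int_of_le_succ (splineSpace_le_succ q hq)
  have hB : bspline q hq ∈ splineSpace q hq 0 := by
    have := translation_bspline_mem q hq 0
    rwa [Int.cast_zero, translation_zero] at this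
  have h1 : (dilation ^ (-(n : ℤ))) (bspline q hq) ∈ splineSpace q hq 0 := by
    have := dilation_zpow_mem (-(n : ℤ)) (hmono (Int.natCast_nonneg n) hB)
    rwa [neg_add_cancel] at this
  have h2 := dilation_zpow_mem (n : ℤ) (translation_mem k h1)
  have h3 := dilation_pow_translation n ((k : ℝ) / 2 ^ n) ((dilation ^ (-(n : ℤ))) (bspline q hq))
  rw [mul_div_cancel₀ _ (by positivity), ← dilation_zpow_add_apply, add_neg_cancel, zpow_zero]
    at h3
  rw [add_zero, h3] at h2
  exact h2

theorem eq_zero_of_dyadic {g : ℝ → ℂ} (hg : Continuous g)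
    (h : ∀ (n : ℕ) (k : ℤ), g (k / 2 ^ n) = 0) : g = 0 := by
  ext t
  have h1 : Filter.Tendsto (fun n : ℕ => ((⌊t * 2 ^ n⌋ : ℤ) : ℝ) / 2 ^ n) Filter.atTop (nhds t) := by
    have h2 : Filter.Tendsto (fun n : ℕ => (2 : ℝ) ^ n) Filter.atTop Filter.atTop :=
      tendsto_pow_atTop_atTop_of_one_lt one_lt_two
    have h3 := h2.inv_tendsto_atTop
    refine tendsto_of_tendsto_of_tendsto_of_le_of_le (g := fun n : ℕ => t - ((2 : ℝ) ^ n)⁻¹)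
      (h := fun _ => t) (by simpa using h3.const_sub t) tendsto_const_nhds (fun n => ?_)
      (fun n => ?_)
    · have hp : (0 : ℝ) < 2 ^ n := by positivity
      simp only
      rw [le_div_iff₀ hp, sub_mul, inv_mul_cancel₀ hp.ne']
      exact (Int.sub_one_lt_floor _).le
    · have hp : (0 : ℝ) < 2 ^ n := by positivity
      simp only
      rw [div_le_iff₀ hp]
      exact Int.floor_le _
  have h2 := (hg.tendsto t).comp h1
  refine tendsto_nhds_unique h2 ?_
  simp only [Function.comp_def, h]
  exact tendsto_const_nhds

/-- By Plancherel, pairing `f` with `c T_{k/2^n} B_q` gives the Fourier transform of the integrable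
function `⟨f̂, c Ξ^q⟩` at `k/2^n`. This transform is continuous, so vanishing at dyadic points makes
it zero. -/
theorem ae_inner_eq_zero {q : ℍ[ℝ]} {hq : 1 < q.re} {f : L2HC}
    (hf : ∀ n, ∀ g ∈ splineSpace q hq n, inner ℂ f g = 0) (c : HC) :
    ∀ᵐ ξ : ℝ, inner ℂ ((𝓕 f : L2HC) ξ) (c * qpow (Xi (2 * Real.pi * ξ)) q) = 0 := by
  set g : L2HC := leftMul c (𝓕 (bspline q hq)) with hg
  have hint : Integrable fun ξ => inner ℂ ((𝓕 f : L2HC) ξ) (g ξ) := L2.integrable_inner _ _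
  have hfour : 𝓕 (fun ξ => inner ℂ ((𝓕 f : L2HC) ξ) (g ξ)) = 0 := by
    refine eq_zero_of_dyadic (VectorFourier.fourierIntegral_continuous
      Real.continuous_fourierChar (by exact continuous_inner) hint) fun n k => ?_
    have h1 := hf n _ (leftMul_mem_closedLeftSpan c (translation_dyadic_mem q hq n k))
    rw [← Lp.inner_fourier_eq, fourier_leftMul, fourier_translation, leftMul_bcfMul, ← hg,
      L2.inner_def] at h1
    rw [Real.fourier_real_eq, ← h1]
    refine integral_congr_ae ?_
    filter_upwards [coeFn_bcfMul (character (k / 2 ^ n)) g] with ξ h2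
    rw [h2, inner_smul_right, character_apply, Circle.smul_def, smul_eq_mul]
  filter_upwards [ae_eq_zero_of_fourier_eq_zero hint hfour,
    coeFn_leftMul c (𝓕 (bspline q hq)), fourier_bspline q hq] with ξ h1 h2 h3
  rw [← h1, hg, h2, h3]

theorem exists_mul_qpow_eq (q : ℍ[ℝ]) (z : ℂ) (p : HC) :
    ∃ c : HC, c * qpow z q = z ^ (q.re : ℂ) • p := by
  refine ⟨p * rotor q (-Complex.log z), ?_⟩
  rw [qpow_eq, mul_smul_comm, mul_assoc, ← rotor_add, neg_add_cancel, rotor_zero, mul_one]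

theorem ae_Xi_ne_zero : ∀ᵐ ξ : ℝ, Xi (2 * Real.pi * ξ) ≠ 0 := by
  filter_upwards [ae_sin_two_pi_ne_zero] with ξ hξ h
  have h0 : 2 * Real.pi * ξ ≠ 0 := fun h0 => hξ (by rw [h0, Real.sin_zero])
  have h1 := im_Xi h0
  rw [h, Complex.zero_im, eq_comm, div_eq_zero_iff, or_iff_left h0] at h1
  have h2 := Real.sin_sq_add_cos_sq (2 * Real.pi * ξ)
  rw [sub_eq_zero.1 h1] at h2
  exact hξ (by nlinarith)

theorem eq_zero_of_orthogonal {q : ℍ[ℝ]} {hq : 1 < q.re} {f : L2HC}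
    (hf : ∀ n, ∀ g ∈ splineSpace q hq n, inner ℂ f g = 0) : f = 0 := by
  -- The exceptional null set depends on `c`. Restricting to a finite basis gives a common one, and
  -- linearity then allows a `c` depending on `ξ`.
  have hae : ∀ᵐ ξ : ℝ, ∀ i, inner ℂ ((𝓕 f : L2HC) ξ)
      (Module.finBasis ℂ HC i * qpow (Xi (2 * Real.pi * ξ)) q) = 0 :=
    ae_all_iff.2 fun i => ae_inner_eq_zero hf _
  have hzero : (𝓕 f : L2HC) = 0 := by
    apply Lp.ext
    filter_upwards [hae, ae_Xi_ne_zero, Lp.coeFn_zero HC 2 (volume : Measure ℝ)] with ξ h1 h2 h3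
    have h4 : (innerSL ℂ ((𝓕 f : L2HC) ξ)).toLinearMap ∘ₗ
        LinearMap.mulRight ℂ (qpow (Xi (2 * Real.pi * ξ)) q) = 0 :=
      (Module.finBasis ℂ HC).ext fun i => h1 i
    -- This `c` makes the second entry `Ξ^a f̂(ξ)`, so the pairing is `Ξ^a ‖f̂(ξ)‖²` with `Ξ^a ≠ 0`.
    obtain ⟨c, hc⟩ := exists_mul_qpow_eq q (Xi (2 * Real.pi * ξ)) ((𝓕 f : L2HC) ξ)
    have h5 : inner ℂ ((𝓕 f : L2HC) ξ) (c * qpow (Xi (2 * Real.pi * ξ)) q) = 0 :=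
      LinearMap.congr_fun h4 c
    rw [hc, inner_smul_right, mul_eq_zero, inner_self_eq_zero] at h5
    have h6 : Xi (2 * Real.pi * ξ) ^ (q.re : ℂ) ≠ 0 := by
      rw [Ne, Complex.cpow_eq_zero_iff]
      exact fun h => h2 h.1
    rw [h5.resolve_left h6, h3]
    rfl
  rw [← norm_eq_zero, ← Lp.norm_fourier_eq, hzero, norm_zero]

theorem dense_iUnion_splineSpace (q : ℍ[ℝ]) (hq : 1 < q.re) :
    Dense (⋃ n, (splineSpace q hq n : Set L2HC)) := by
  have hmono : Monotone (splineSpace q hq) := monotone_int_of_le_succ (splineSpace_le_succ q hq)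
  -- By nesting the union is a subspace, so density means that its orthogonal complement is trivial.
  rw [← Submodule.coe_iSup_of_directed _ hmono.directed_le, Submodule.dense_iff_topologicalClosure_eq_top,
    Submodule.topologicalClosure_eq_top_iff, Submodule.eq_bot_iff]
  intro f hf
  refine eq_zero_of_orthogonal (q := q) (hq := hq) fun n g hg => ?_
  exact Submodule.inner_left_of_mem_orthogonal (Submodule.mem_iSup_of_mem n hg) hf

end QuaternionicSpline

end

theorem mainTheorem3 (q : Quaternion ℝ) (hq : 1 < q.re) :
    QuaternionicSpline.IsDyadicMRA (QuaternionicSpline.splineSpace q hq)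
      (QuaternionicSpline.bspline q hq) where
  isClosed _ := QuaternionicSpline.isClosed_closedLeftSpan _
  leftMul_mem _ c _ hf := QuaternionicSpline.leftMul_mem_closedLeftSpan c hf
  nested := QuaternionicSpline.splineSpace_le_succ q hq
  dense_iUnion := QuaternionicSpline.dense_iUnion_splineSpace q hq
  iInter_eq := QuaternionicSpline.iInter_splineSpace q hq
  dilation_mem_iff := QuaternionicSpline.dilation_mem_iff
  translation_mem_iff := QuaternionicSpline.translation_mem_iff
  rieszBasis := by
    obtain ⟨A, hA, HA⟩ := QuaternionicSpline.exists_le_comb_norm q hq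
    obtain ⟨B, hB, HB⟩ := QuaternionicSpline.exists_comb_norm_le q hq
    exact ⟨rfl, A, B, hA, hB, fun c => ⟨HA c, HB c⟩⟩
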